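/- Theorem (Topological Hitting Set is FPT in $k+\Delta$). All simplicial complexes are finite, and homology has $\mathbb{Z}_2$ coefficients. Let $\mathsf K$ be a $d$-dimensional complex, $r<d$ a natural number and $\zeta\in \mathsf Z_r(\mathsf K)$ a non-bounding cycle. A topological hitting set of $\zeta$ is a set $\mathcal S$ of $r$-simplices that meets every $r$-cycle homologous to $\zeta$. The Hasse graph $H_{\mathsf K}$ has a node for every (nonempty) simplex and an edge for every facet-cofacet pair; the subgraph induced by a set $\mathcal S$ of $r$-simplices is the induced subgraph on $\mathcal S$ together with all $(r+1)$-simplices having a facet in $\mathcal S$. (1) Every inclusion-minimal topological hitting set $\mathcal S$ of $\zeta$ induces a connected subgraph of $H_{\mathsf K}$. If $|\mathcal S|\le k$, then $\mathcal S$ is contained in the ball of radius $2k$ of $H_{\mathsf K}$ around each of its members. (2) Hence, for every natural number $k$, there is a topological hitting set of size at most $k$ if and only if for some $r$-simplex $\tau$ there is one of size at most $k$ that induces a connected subgraph of $H_{\mathsf K}$ and all of whose members are within Hasse-graph distance $2k$ of $\tau$. (3) There is a deterministic algorithm for Topological Hitting Set: given $(\mathsf K,k,r,\zeta)$ as above,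 it decides whether $\zeta$ has a topological hitting set of size at most $k$, and if so returns one of minimum size. It runs in time $O\bigl(n^{6+\omega}\cdot 2^{O(k\log (k\Delta))}\bigr)$, where $n$ is the number of simplices of $\mathsf K$, $\Delta$ is the maximum degree of $H_{\mathsf K}$ and $\omega$ is the exponent of matrix multiplication over $\mathbb{Z}_2$ (for $k=0$, $k\log(k\Delta)$ is read as $0$). In particular it runs in time $f(k+\Delta)\cdot n^{O(1)}$ for a computable function $f$, so the problem is fixed-parameter tractable with respect to $k+\Delta$. Time is counted in unit-cost operations of a word RAM with words of $O(\log (n+k))$ bits, whose input lists the simplices, in any order, by their vertex sets, together with $r$, $k$ and the members of $\zeta$. -/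

import Mathlib

/-! ### Finite simplicial complexes, their Hasse graphs, and homology over the field with two
elements -/

namespace AbstractSimplicialComplex

variable {V : Type*} [Finite V]

/-- The type of all (nonempty) simplices of `K`. -/
abbrev Simplex (K : AbstractSimplicialComplex V) : Type _ := {s : Finset V // s ∈ K.faces}

/-- The type of `p`-dimensional simplices of `K`, i.e. those with `p + 1` vertices. -/
abbrev Face (K : AbstractSimplicialComplex V) (p : ℕ) : Type _ :=
  {s : Finset V // s ∈ K.faces ∧ s.card = p + 1}

noncomputable instance (K : AbstractSimplicialComplex V) : Fintype K.Simplex := Fintype.ofFinite _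

noncomputable instance (K : AbstractSimplicialComplex V) (p : ℕ) : Fintype (K.Face p) :=
  Fintype.ofFinite _

/-- A `p`-simplex, regarded as a simplex. -/
def Face.toSimplex {K : AbstractSimplicialComplex V} {p : ℕ} (s : K.Face p) : K.Simplex :=
  ⟨s.1, s.2.1⟩

/-- The number of simplices of `K`. -/
noncomputable def size (K : AbstractSimplicialComplex V) : ℕ := Fintype.card K.Simplex

/-- The dimension of `K`: the largest dimension of a simplex. -/
noncomputable def dim (K : AbstractSimplicialComplex V) : ℕ :=
  Finset.univ.sup fun s : K.Simplex => s.1.card - 1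

/-- `s` is a facet of `t`: a face of codimension one. -/
def IsFacet {K : AbstractSimplicialComplex V} (s t : K.Simplex) : Prop :=
  s.1 ⊆ t.1 ∧ t.1.card = s.1.card + 1

/-- The Hasse graph: one node per simplex and one edge per facet-cofacet pair. -/
def hasseGraph (K : AbstractSimplicialComplex V) : SimpleGraph K.Simplex where
  Adj s t := IsFacet s t ∨ IsFacet t s
  symm := ⟨fun _ _ h => h.symm⟩
  loopless := ⟨fun s h => by
    have h' : s.1.card = s.1.card + 1 := h.elim And.right And.right
    omega⟩

open Classical in
/-- The maximum degree of the Hasse graph. -/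
noncomputable def maxHasseDegree (K : AbstractSimplicialComplex V) : ℕ := K.hasseGraph.maxDegree

/-- `p`-chains with coefficients in the field with two elements. -/
abbrev Chain (K : AbstractSimplicialComplex V) (p : ℕ) : Type _ := K.Face p → ZMod 2

open Classical in
/-- The matrix of the boundary homomorphism from `(p + 1)`-chains to `p`-chains. -/
noncomputable def boundaryMatrix (K : AbstractSimplicialComplex V) (p : ℕ) :
    Matrix (K.Face p) (K.Face (p + 1)) (ZMod 2) :=
  Matrix.of fun s t => if s.1 ⊆ t.1 then 1 else 0

/-- The boundary homomorphism from `(p + 1)`-chains to `p`-chains. -/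
noncomputable def boundary (K : AbstractSimplicialComplex V) (p : ℕ) :
    K.Chain (p + 1) →ₗ[ZMod 2] K.Chain p :=
  (K.boundaryMatrix p).mulVecLin

/-- `p`-cycles; every `0`-chain is a cycle. -/
noncomputable def cycles (K : AbstractSimplicialComplex V) :
    (p : ℕ) → Submodule (ZMod 2) (K.Chain p)
  | 0 => ⊤
  | p + 1 => LinearMap.ker (K.boundary p)

/-- `p`-boundaries. -/
noncomputable def boundaries (K : AbstractSimplicialComplex V) (p : ℕ) :
    Submodule (ZMod 2) (K.Chain p) :=
  LinearMap.range (K.boundary p)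

/-- `S` is a topological hitting set of the cycle `ζ`: it meets every cycle homologous to `ζ`. -/
def IsHittingSet (K : AbstractSimplicialComplex V) {r : ℕ} (ζ : K.Chain r)
    (S : Finset (K.Face r)) : Prop :=
  ∀ z ∈ K.cycles r, z - ζ ∈ K.boundaries r → ∃ s ∈ S, z s ≠ 0

/-- The nodes of the subgraph of the Hasse graph induced by a set `S` of `r`-simplices: the
members of `S` together with the `(r + 1)`-simplices incident on `S`. -/
def inducedNodes (K : AbstractSimplicialComplex V) {r : ℕ} (S : Finset (K.Face r)) :
    Set K.Simplex :=
  {x | ∃ s ∈ S, x = s.toSimplex ∨ IsFacet s.toSimplex x}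

/-- `S` induces a connected (in particular nonempty) subgraph of the Hasse graph. -/
def InducesConnected (K : AbstractSimplicialComplex V) {r : ℕ} (S : Finset (K.Face r)) : Prop :=
  (K.hasseGraph.induce (K.inducedNodes S)).Connected

/-- All simplices within Hasse-graph distance `R` of the simplex `x`. -/
def hasseBall (K : AbstractSimplicialComplex V) (x : K.Simplex) (R : ℕ) : Set K.Simplex :=
  {y | K.hasseGraph.edist x y ≤ R}

end AbstractSimplicialComplex

/-! ### The exponent of matrix multiplication -/

/-- The bilinear map `(A, B) ↦ A * B` on `n × n` matrices over `F` is a sum of `R` terms, each a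
product of a linear form in `A`, a linear form in `B` and a fixed matrix. -/
def MatMulRankLE (F : Type*) [Field F] (n R : ℕ) : Prop :=
  ∃ (u v : Fin R → (Matrix (Fin n) (Fin n) F →ₗ[F] F)) (w : Fin R → Matrix (Fin n) (Fin n) F),
    ∀ A B : Matrix (Fin n) (Fin n) F, A * B = ∑ t, (u t A * v t B) • w t

/-- The exponent of matrix multiplication over `F`: the infimum of all `τ` for which the bilinear
complexity (tensor rank) of multiplying two `n × n` matrices is `O(n ^ τ)`. -/
noncomputable def matMulExponent (F : Type*) [Field F] : ℝ :=
  sInf {τ : ℝ | ∃ C : ℝ, ∀ n : ℕ, 0 < n → ∃ R : ℕ, MatMulRankLE F n R ∧ (R : ℝ) ≤ C * (n : ℝ) ^ τ}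

/-! ### A word RAM with a step count

A machine has registers and finitely many (those its program mentions) randomly accessible arrays,
all holding natural numbers. A fixed program is built from assignments, array writes, branching and
loops. Every operation costs one step, and a number may be stored, or used as a write address, only
if it does not exceed a bound `B` (words of `log₂ B` bits); a program that breaks this rule gets
stuck and has no run. As an expression of a fixed program has a fixed number of operations,
intermediate values are bounded by a fixed power of `B`, that is, they fit in `O(1)` words. -/

namespace RAM

/-- Contents of the registers and of the arrays. -/
structure Store where
  reg : ℕ → ℕ
  arr : ℕ → ℕ → ℕ

/-- Expressions: constants, registers, array entries, sum, truncated difference, product. -/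
inductive Expr where
  | lit (c : ℕ)
  | var (x : ℕ)
  | read (a : ℕ) (i : Expr)
  | plus (e₁ e₂ : Expr)
  | minus (e₁ e₂ : Expr)
  | times (e₁ e₂ : Expr)

/-- The value of an expression. -/
def Expr.eval (σ : Store) : Expr → ℕ
  | lit c => c
  | var x => σ.reg x
  | read a i => σ.arr a (i.eval σ)
  | plus e₁ e₂ => e₁.eval σ + e₂.eval σ
  | minus e₁ e₂ => e₁.eval σ - e₂.eval σ
  | times e₁ e₂ => e₁.eval σ * e₂.eval σ

/-- The number of steps needed to evaluate an expression. -/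
def Expr.cost : Expr → ℕ
  | lit _ => 1
  | var _ => 1
  | read _ i => i.cost + 1
  | plus e₁ e₂ => e₁.cost + e₂.cost + 1
  | minus e₁ e₂ => e₁.cost + e₂.cost + 1
  | times e₁ e₂ => e₁.cost + e₂.cost + 1

/-- Programs. A test succeeds if the value of its expression is not zero. -/
inductive Cmd where
  | skip
  | assign (x : ℕ) (e : Expr)
  | write (a : ℕ) (i e : Expr)
  | seq (c₁ c₂ : Cmd)
  | branch (e : Expr) (c₁ c₂ : Cmd)
  | loop (e : Expr) (c : Cmd)

/-- Store the number `n` in register `x`. -/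
def Store.setReg (σ : Store) (x n : ℕ) : Store :=
  { σ with reg := Function.update σ.reg x n }

/-- Store the number `n` at position `i` of array `a`. -/
def Store.setArr (σ : Store) (a i n : ℕ) : Store :=
  { σ with arr := Function.update σ.arr a (Function.update (σ.arr a) i n) }

/-- `Run B c σ t σ'`: with word bound `B`, the program `c` started in `σ` halts in `σ'` after
exactly `t` steps. -/
inductive Run (B : ℕ) : Cmd → Store → ℕ → Store → Prop
  | skip (σ : Store) : Run B .skip σ 1 σ
  | assign (x : ℕ) (e : Expr) (σ : Store) (h : e.eval σ ≤ B) :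
      Run B (.assign x e) σ (e.cost + 1) (σ.setReg x (e.eval σ))
  | write (a : ℕ) (i e : Expr) (σ : Store) (hi : i.eval σ ≤ B) (he : e.eval σ ≤ B) :
      Run B (.write a i e) σ (i.cost + e.cost + 1) (σ.setArr a (i.eval σ) (e.eval σ))
  | seq {c₁ c₂ : Cmd} {σ σ₁ σ₂ : Store} {t₁ t₂ : ℕ} (h₁ : Run B c₁ σ t₁ σ₁)
      (h₂ : Run B c₂ σ₁ t₂ σ₂) : Run B (.seq c₁ c₂) σ (t₁ + t₂) σ₂
  | branch_true {e : Expr} {c₁ c₂ : Cmd} {σ σ₁ : Store} {t : ℕ} (he : e.eval σ ≠ 0)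
      (h : Run B c₁ σ t σ₁) : Run B (.branch e c₁ c₂) σ (e.cost + 1 + t) σ₁
  | branch_false {e : Expr} {c₁ c₂ : Cmd} {σ σ₁ : Store} {t : ℕ} (he : e.eval σ = 0)
      (h : Run B c₂ σ t σ₁) : Run B (.branch e c₁ c₂) σ (e.cost + 1 + t) σ₁
  | loop_done {e : Expr} {c : Cmd} {σ : Store} (he : e.eval σ = 0) :
      Run B (.loop e c) σ (e.cost + 1) σ
  | loop_step {e : Expr} {c : Cmd} {σ σ₁ σ₂ : Store} {t₁ t₂ : ℕ} (he : e.eval σ ≠ 0)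
      (h₁ : Run B c σ t₁ σ₁) (h₂ : Run B (.loop e c) σ₁ t₂ σ₂) :
      Run B (.loop e c) σ (e.cost + 1 + t₁ + t₂) σ₂

end RAM

/-! ### The problem Topological Hitting Set -/

/-- An instance of Topological Hitting Set: a finite simplicial complex with vertices
`0, …, m - 1`, a budget `k`, a dimension `r` below the dimension of the complex, and a
non-bounding `r`-cycle `ζ`. -/
structure THSInstance where
  m : ℕ
  K : AbstractSimplicialComplex (Fin m)
  k : ℕ
  r : ℕ
  r_lt : r < K.dim
  ζ : K.Chain r
  isCycle : ζ ∈ K.cycles r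
  nonbounding : ζ ∉ K.boundaries r

namespace THSInstance

open Classical in
/-- The initial store for the instance `I`, with the `n` simplices listed in the order `e`:
registers 0, 1, 2, 3 hold `n`, `m`, `r`, `k`; array 0 holds the simplices as the rows of an `n × m`
matrix (entry `i * m + j` tells whether the `i`-th simplex has the vertex `j`); array 1 tells which
simplices belong to `ζ`. Everything else is zero. -/
noncomputable def input (I : THSInstance) (e : Fin I.K.size ≃ I.K.Simplex) : RAM.Store where
  reg x := match x with
    | 0 => I.K.size
    | 1 => I.m
    | 2 => I.r
    | 3 => I.k
    | _ => 0
  arr a p := match a with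
    | 0 => if ∃ (i : Fin I.K.size) (j : Fin I.m), p = i * I.m + j ∧ j ∈ (e i).1 then 1 else 0
    | 1 => if ∃ (i : Fin I.K.size) (s : I.K.Face I.r),
        p = i ∧ e i = s.toSimplex ∧ I.ζ s ≠ 0 then 1 else 0
    | _ => 0

open Classical in
/-- The final store `σ` correctly answers the instance `I`: either register 0 holds `1` and array 2
marks the members of a smallest topological hitting set, which has at most `k` members, or register
0 holds `0` and no topological hitting set has at most `k` members. -/
def Answers (I : THSInstance) (e : Fin I.K.size ≃ I.K.Simplex) (σ : RAM.Store) : Prop :=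
  (σ.reg 0 = 1 ∧ ∃ S : Finset (I.K.Face I.r), I.K.IsHittingSet I.ζ S ∧ S.card ≤ I.k ∧
      (∀ T : Finset (I.K.Face I.r), I.K.IsHittingSet I.ζ T → S.card ≤ T.card) ∧
      ∀ i : Fin I.K.size, σ.arr 2 i = if ∃ s ∈ S, e i = s.toSimplex then 1 else 0) ∨
  (σ.reg 0 = 0 ∧
      ¬ ∃ S : Finset (I.K.Face I.r), I.K.IsHittingSet I.ζ S ∧ S.card ≤ I.k)

end THSInstance

/-! Over the field with two elements a set of `r`-simplices is a cochain. A cocycle whose value at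
`ζ` is odd (`IsOddCocycle`) has value 1 on the whole homology class of `ζ`, so it meets every cycle
in that class. Conversely, if `S` is a hitting set, then `ζ` is not the sum of a boundary and a
chain vanishing on `S`; a linear functional separating `ζ` from all such sums is an odd cocycle
supported in `S` (`IsHittingSet.exists_isOddCocycle`). Minimal hitting sets are therefore minimal
odd cocycles.

Connectedness: splitting a cocycle into two parts without a common cofacet leaves two cocycles, and
their values at `ζ` add up to 1, so one part is already odd. A minimal hitting set hence cannot be
split. A path between two of its at most `k` members has fewer than `k` edges, each of them a Hasse
walk of length two; this gives the radius `2k`. The second claim follows by passing to a minimal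
subset.

Algorithm: let `Y` be a nonempty proper subset of a minimum odd cocycle `T`. If `Y` is not a
cocycle, some `(r + 1)`-simplex has an odd number of facets in `Y` but an even number in `T`, so one
of its at most `Δ` facets lies in `T` and not in `Y`: branch over these. If `Y` were a cocycle, `Y`
or `T \ Y` would be a smaller odd cocycle (`Data.IsMinimum.exists_valid`). With at most `n` choices
for the first simplex and depth `k`, the search takes at most `(n + 1)^2 (Δ + 1)^k` steps, each
costing `O(n^2)` on the word RAM. The total is within the claimed bound because `ω ≥ 0` and `Δ ≥ 2`;
neither matrix multiplication nor Hasse balls enter the algorithm. -/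

namespace AbstractSimplicialComplex

variable {V : Type*} [Finite V]

set_option linter.unusedSectionVars false

/-! ### Boundaries are cycles. -/

theorem boundary_apply (K : AbstractSimplicialComplex V) (p : ℕ) (c : K.Chain (p + 1))
    (s : K.Face p) : K.boundary p c s = ∑ u, K.boundaryMatrix p s u * c u := rfl

open Classical in
/-- Between a `p`-simplex and a `(p + 2)`-simplex there are evenly many `(p + 1)`-simplices. -/
theorem boundaryMatrix_mul_boundaryMatrix (K : AbstractSimplicialComplex V) (p : ℕ) :
    K.boundaryMatrix p * K.boundaryMatrix (p + 1) = 0 := by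
  ext s t
  rw [Matrix.mul_apply, Matrix.zero_apply]
  have h : ∀ u : K.Face (p + 1), K.boundaryMatrix p s u * K.boundaryMatrix (p + 1) u t
      = if s.1 ⊆ u.1 ∧ u.1 ⊆ t.1 then 1 else 0 := by
    intro u
    by_cases h₁ : s.1 ⊆ u.1 <;> by_cases h₂ : u.1 ⊆ t.1 <;> simp [boundaryMatrix, h₁, h₂]
  rw [Finset.sum_congr rfl fun u _ => h u, ← Finset.sum_filter]
  have card : ∀ u : Finset V, u ∈ K.faces ∧ u.card = p + 1 + 1 → s.1 ⊆ u → u ⊆ t.1 →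
      (s.1 ∪ t.1 \ u).card = p + 1 + 1 := by
    intro u hu h₁ h₂
    rw [Finset.card_union_of_disjoint, Finset.card_sdiff_of_subset h₂, s.2.2, t.2.2, hu.2]
    · omega
    · exact (Finset.sdiff_disjoint.mono_right h₁).symm
  -- If `s ⊆ u ⊆ t` with codimension one at each inclusion, `s ∪ (t \ u)` is the other simplex
  -- between `s` and `t`; the terms cancel in pairs.
  refine Finset.sum_involution
    (fun u hu => ⟨s.1 ∪ t.1 \ u.1, ?_, card u.1 u.2 (Finset.mem_filter.1 hu).2.1
      (Finset.mem_filter.1 hu).2.2⟩) ?_ ?_ ?_ ?_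
  · have h' := (Finset.mem_filter.1 hu).2
    refine (K.isRelLowerSet_faces t.2.1).2
      (Finset.union_subset (h'.1.trans h'.2) Finset.sdiff_subset) ?_
    rw [← Finset.card_pos, card u.1 u.2 h'.1 h'.2]
    omega
  · intros
    exact CharTwo.add_self_eq_zero (1 : ZMod 2)
  · intro u hu _ h'
    obtain ⟨h₁, h₂⟩ := (Finset.mem_filter.1 hu).2
    have h₃ : (t.1 \ u.1).Nonempty := by
      rw [← Finset.card_pos, Finset.card_sdiff_of_subset h₂, t.2.2, u.2.2]
      omega
    obtain ⟨x, hx⟩ := h₃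
    have h₄ : x ∈ u.1 := by
      rw [← congrArg Subtype.val h']
      exact Finset.mem_union_right _ hx
    exact (Finset.mem_sdiff.1 hx).2 h₄
  · intro u hu
    obtain ⟨h₁, h₂⟩ := (Finset.mem_filter.1 hu).2
    refine Finset.mem_filter.2 ⟨Finset.mem_univ _, Finset.subset_union_left, ?_⟩
    exact Finset.union_subset (h₁.trans h₂) Finset.sdiff_subset
  · intro u hu
    obtain ⟨h₁, h₂⟩ := (Finset.mem_filter.1 hu).2
    apply Subtype.ext
    ext x
    have := @h₁ x
    have := @h₂ x
    simp only [Finset.mem_union, Finset.mem_sdiff]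
    tauto

theorem boundaries_le_cycles (K : AbstractSimplicialComplex V) (p : ℕ) :
    K.boundaries p ≤ K.cycles p := by
  cases p with
  | zero => exact le_top
  | succ p =>
    rintro _ ⟨c, rfl⟩
    change K.boundary p (K.boundary (p + 1) c) = 0
    simp only [boundary, Matrix.mulVecLin_apply, Matrix.mulVec_mulVec,
      boundaryMatrix_mul_boundaryMatrix, Matrix.zero_mulVec]

/-! ### Duality between hitting sets and odd cocycles. -/

/-- `Y`, regarded as a cochain, is a cocycle. -/
def IsCocycle (K : AbstractSimplicialComplex V) {r : ℕ} (Y : Finset (K.Face r)) : Prop :=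
  ∀ u : K.Face (r + 1), ∑ s ∈ Y, K.boundaryMatrix r s u = 0

/-- `Y` is a cocycle whose value at the chain `ζ` is `1`. -/
def IsOddCocycle (K : AbstractSimplicialComplex V) {r : ℕ} (ζ : K.Chain r)
    (Y : Finset (K.Face r)) : Prop :=
  K.IsCocycle Y ∧ ∑ s ∈ Y, ζ s = 1

theorem IsCocycle.sum_boundary {K : AbstractSimplicialComplex V} {r : ℕ} {Y : Finset (K.Face r)}
    (hY : K.IsCocycle Y) (c : K.Chain (r + 1)) : ∑ s ∈ Y, K.boundary r c s = 0 := by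
  simp only [boundary_apply]
  rw [Finset.sum_comm]
  refine Finset.sum_eq_zero fun u _ => ?_
  rw [← Finset.sum_mul, hY u, zero_mul]

/-- A cocycle vanishes on boundaries, so its value at any chain homologous to `ζ` is still 1, and
some term of the sum is nonzero. -/
theorem IsOddCocycle.isHittingSet {K : AbstractSimplicialComplex V} {r : ℕ} {ζ : K.Chain r}
    {Y : Finset (K.Face r)} (hY : K.IsOddCocycle ζ Y) : K.IsHittingSet ζ Y := by
  rintro z - ⟨c, hc⟩
  apply Finset.exists_ne_zero_of_sum_ne_zero
  have h : z = ζ + K.boundary r c := by rw [hc]; abel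
  simp only [h, Pi.add_apply, Finset.sum_add_distrib, hY.2, hY.1.sum_boundary]
  decide

theorem IsHittingSet.mono {K : AbstractSimplicialComplex V} {r : ℕ} {ζ : K.Chain r}
    {S T : Finset (K.Face r)} (hS : K.IsHittingSet ζ S) (h : S ⊆ T) : K.IsHittingSet ζ T :=
  fun z hz hz' => (hS z hz hz').imp fun _ hs => ⟨h hs.1, hs.2⟩

open Classical in
/-- Every topological hitting set contains an odd cocycle. -/
theorem IsHittingSet.exists_isOddCocycle {K : AbstractSimplicialComplex V} {r : ℕ}
    {ζ : K.Chain r} (hζ : ζ ∈ K.cycles r) {S : Finset (K.Face r)} (hS : K.IsHittingSet ζ S) :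
    ∃ Y ⊆ S, K.IsOddCocycle ζ Y := by
  -- `W` consists of the chains vanishing on `S`. Were `ζ = b + w` with `b` a boundary and `w` in
  -- `W`, then `w` would be a cycle homologous to `ζ` that `S` misses.
  let W : Submodule (ZMod 2) (K.Chain r) := ⨅ s ∈ S, LinearMap.ker (LinearMap.proj s)
  have hW : ∀ w, w ∈ W ↔ ∀ s ∈ S, w s = 0 := by
    intro w
    simp [W, Submodule.mem_iInf]
  have hζ' : ζ ∉ K.boundaries r ⊔ W := by
    intro h
    obtain ⟨b, hb, w, hw, rfl⟩ := Submodule.mem_sup.1 h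
    have hwc : w ∈ K.cycles r := by
      have := Submodule.sub_mem _ hζ (K.boundaries_le_cycles r hb)
      rwa [add_sub_cancel_left] at this
    obtain ⟨s, hs, hs'⟩ := hS w hwc (by
      rw [show w - (b + w) = -b by abel]
      exact Submodule.neg_mem _ hb)
    exact hs' ((hW w).1 hw s hs)
  -- The required cocycle is the support of `f`: vanishing on `W` puts it inside `S`, vanishing on
  -- boundaries makes it a cocycle, and `f ζ ≠ 0` makes it odd.
  obtain ⟨f, hf, hle⟩ := Submodule.exists_le_ker_of_notMem hζ'
  have two : ∀ x : ZMod 2, x ≠ 0 → x = 1 := by decide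
  have hfc : ∀ c : K.Chain r,
      ∑ s ∈ Finset.univ.filter (fun s => f (Pi.single s 1) ≠ 0), c s = f c := by
    intro c
    rw [f.pi_apply_eq_sum_univ c, Finset.sum_filter]
    refine Finset.sum_congr rfl fun s _ => ?_
    have he : (fun j => if s = j then (1 : ZMod 2) else 0) = Pi.single s 1 := by
      ext j
      simp [Pi.single_apply, eq_comm]
    rw [he, smul_eq_mul]
    split_ifs with h
    · rw [two _ h, mul_one]
    · rw [not_not.1 h, mul_zero]
  refine ⟨Finset.univ.filter (fun s => f (Pi.single s 1) ≠ 0), ?_, ?_, ?_⟩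
  · intro s hs
    by_contra hsS
    refine (Finset.mem_filter.1 hs).2 (hle (Submodule.mem_sup_right ((hW _).2 ?_)))
    intro s' hs'
    exact Pi.single_eq_of_ne (by rintro rfl; exact hsS hs') 1
  · intro u
    have hb : (fun s => K.boundaryMatrix r s u) ∈ K.boundaries r := by
      refine ⟨Pi.single u 1, ?_⟩
      ext s
      rw [boundary_apply]
      simp [Pi.single_apply]
    rw [hfc fun s => K.boundaryMatrix r s u]
    exact hle (Submodule.mem_sup_left hb)
  · rw [hfc]
    exact two _ hf

/-! ### Connectedness and diameter of minimal hitting sets. -/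

/-- The graph on `r`-simplices whose edges are the pairs with a common cofacet. -/
def cofacetGraph (K : AbstractSimplicialComplex V) (r : ℕ) : SimpleGraph (K.Face r) where
  Adj s t := s ≠ t ∧ ∃ u : K.Face (r + 1), s.1 ⊆ u.1 ∧ t.1 ⊆ u.1
  symm := ⟨fun _ _ ⟨h, u, hs, ht⟩ => ⟨h.symm, u, ht, hs⟩⟩
  loopless := ⟨fun _ h => h.1 rfl⟩

/-- A part of a cocycle that shares no cofacet with the rest is a cocycle. -/
theorem IsCocycle.filter {K : AbstractSimplicialComplex V} {r : ℕ} {Y : Finset (K.Face r)}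
    (hY : K.IsCocycle Y) (P : K.Face r → Prop)
    [DecidablePred P] (hP : ∀ s ∈ Y, ∀ t ∈ Y, (K.cofacetGraph r).Adj s t → P s → P t) :
    K.IsCocycle (Y.filter P) := by
  intro u
  have hu : ∀ t : K.Face r, ¬ t.1 ⊆ u.1 → K.boundaryMatrix r t u = 0 := fun t ht => by
    simp [boundaryMatrix, ht]
  rw [Finset.sum_filter]
  -- The facets of `u` in `Y` are pairwise adjacent, so `P` holds for all of them or for none: the
  -- filtered sum is the full one or zero.
  by_cases h : ∃ s ∈ Y, s.1 ⊆ u.1 ∧ P s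
  · obtain ⟨s, hs, hsu, hPs⟩ := h
    refine (Finset.sum_congr rfl fun t ht => ?_).trans (hY u)
    split_ifs with hPt
    · rfl
    · have : ¬ t.1 ⊆ u.1 := fun htu =>
        hPt (hP s hs t ht ⟨fun h => hPt (h ▸ hPs), u, hsu, htu⟩ hPs)
      rw [hu t this]
  · refine Finset.sum_eq_zero fun t ht => ?_
    split_ifs with hPt
    · have : ¬ t.1 ⊆ u.1 := fun htu => h ⟨t, ht, htu, hPt⟩
      exact hu t this
    · rfl

/-- The odd cocycle inside `S` is itself a hitting set, so minimality makes it all of `S`. -/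
theorem isOddCocycle_of_minimal {K : AbstractSimplicialComplex V} {r : ℕ} {ζ : K.Chain r}
    (hζ : ζ ∈ K.cycles r) {S : Finset (K.Face r)} (hS : Minimal (K.IsHittingSet ζ) S) :
    K.IsOddCocycle ζ S := by
  obtain ⟨Y, hYS, hY⟩ := hS.1.exists_isOddCocycle hζ
  have h : Y = S := hS.eq_of_le hY.isHittingSet hYS
  rwa [← h]

theorem IsOddCocycle.nonempty {K : AbstractSimplicialComplex V} {r : ℕ} {ζ : K.Chain r}
    {Y : Finset (K.Face r)} (hY : K.IsOddCocycle ζ Y) : Y.Nonempty := by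
  by_contra h
  have := hY.2
  rw [Finset.not_nonempty_iff_eq_empty.1 h, Finset.sum_empty] at this
  exact zero_ne_one this

open Classical in
/-- A minimal topological hitting set is connected via cofacets. -/
theorem cofacetGraph_induce_connected {K : AbstractSimplicialComplex V} {r : ℕ} {ζ : K.Chain r}
    (hζ : ζ ∈ K.cycles r) {S : Finset (K.Face r)} (hS : Minimal (K.IsHittingSet ζ) S) :
    ((K.cofacetGraph r).induce (S : Set (K.Face r))).Connected := by
  have hodd := isOddCocycle_of_minimal hζ hS
  obtain ⟨s₀, hs₀⟩ := hodd.nonempty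
  have : Nonempty (S : Set (K.Face r)) := ⟨⟨s₀, hs₀⟩⟩
  refine ⟨fun a b => ?_⟩
  let P : K.Face r → Prop := fun s =>
    ∃ hs : s ∈ S, ((K.cofacetGraph r).induce (S : Set (K.Face r))).Reachable a ⟨s, hs⟩
  have hP : ∀ s ∈ S, ∀ t ∈ S, (K.cofacetGraph r).Adj s t → P s → P t := by
    rintro s hs t ht hst ⟨_, h⟩
    exact ⟨ht, h.trans (SimpleGraph.Adj.reachable hst)⟩
  have h₁ := hodd.1.filter P hP
  have h₂ := hodd.1.filter (fun s => ¬ P s)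
    fun s hs t ht hst hs' ht' => hs' (hP t ht s hs hst.symm ht')
  have hsum := hodd.2
  rw [← Finset.sum_filter_add_sum_filter_not S P] at hsum
  have two : ∀ x y : ZMod 2, x + y = 1 → x = 1 ∨ y = 1 := by decide
  -- The odd part is a hitting set inside `S`, hence equals `S`. It must be the part reachable from
  -- `a`, since the other one omits `a`; so `b` is reachable.
  rcases two _ _ hsum with h | h
  · have hle := hS.2 (IsOddCocycle.isHittingSet ⟨h₁, h⟩) (Finset.filter_subset _ _)
    exact (Finset.mem_filter.1 (hle b.2)).2.2
  · have hle := hS.2 (IsOddCocycle.isHittingSet ⟨h₂, h⟩) (Finset.filter_subset _ _)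
    exact absurd ⟨a.2, .refl _⟩ (Finset.mem_filter.1 (hle a.2)).2

theorem Face.isFacet_toSimplex {K : AbstractSimplicialComplex V} {r : ℕ} {s : K.Face r}
    {u : K.Face (r + 1)} (h : s.1 ⊆ u.1) : IsFacet s.toSimplex u.toSimplex :=
  ⟨h, by change u.1.card = s.1.card + 1; rw [u.2.2, s.2.2]⟩

/-- A common cofacet of two members is itself an induced node, so each edge becomes a Hasse path of
length two inside the induced subgraph; every remaining node is adjacent to a member. -/
theorem inducesConnected_of_cofacetGraph {K : AbstractSimplicialComplex V} {r : ℕ}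
    {S : Finset (K.Face r)}
    (h : ((K.cofacetGraph r).induce (S : Set (K.Face r))).Connected) : K.InducesConnected S := by
  let emb : ↥(S : Set (K.Face r)) → K.inducedNodes S :=
    fun s => ⟨s.1.toSimplex, s.1, s.2, Or.inl rfl⟩
  have hadj : ∀ a b, ((K.cofacetGraph r).induce (S : Set (K.Face r))).Adj a b →
      (K.hasseGraph.induce (K.inducedNodes S)).Reachable (emb a) (emb b) := by
    rintro a b ⟨_, u, hu, hu'⟩
    have ha := Face.isFacet_toSimplex hu
    have hb := Face.isFacet_toSimplex hu'
    let x : K.inducedNodes S := ⟨u.toSimplex, a.1, a.2, Or.inr ha⟩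
    have h₁ : (K.hasseGraph.induce (K.inducedNodes S)).Adj (emb a) x := Or.inl ha
    have h₂ : (K.hasseGraph.induce (K.inducedNodes S)).Adj x (emb b) := Or.inr hb
    exact h₁.reachable.trans h₂.reachable
  have hreach : ∀ a b, (K.hasseGraph.induce (K.inducedNodes S)).Reachable (emb a) (emb b) := by
    intro a b
    obtain ⟨w⟩ := h.preconnected a b
    induction w with
    | nil => exact .refl _
    | cons hab _ ih => exact (hadj _ _ hab).trans ih
  have hnode : ∀ x, ∃ a, (K.hasseGraph.induce (K.inducedNodes S)).Reachable x (emb a) := by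
    rintro ⟨x, s, hs, rfl | hx⟩
    · exact ⟨⟨s, hs⟩, .refl _⟩
    · exact ⟨⟨s, hs⟩, SimpleGraph.Adj.reachable (Or.inr hx)⟩
  have : Nonempty (K.inducedNodes S) := h.nonempty.map emb
  refine ⟨fun x y => ?_⟩
  obtain ⟨a, ha⟩ := hnode x
  obtain ⟨b, hb⟩ := hnode y
  exact ha.trans ((hreach a b).trans hb.symm)

-- A simple path inside `S` has fewer than `S.card` edges, and each edge costs two Hasse steps
-- through a common cofacet.
open Classical in
theorem mem_hasseBall_of_cofacetGraph {K : AbstractSimplicialComplex V} {r : ℕ}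
    {S : Finset (K.Face r)}
    (h : ((K.cofacetGraph r).induce (S : Set (K.Face r))).Connected) {k : ℕ} (hk : S.card ≤ k)
    {τ s : K.Face r} (hτ : τ ∈ S) (hs : s ∈ S) :
    s.toSimplex ∈ K.hasseBall τ.toSimplex (2 * k) := by
  have hw : ∀ (a b : (S : Set (K.Face r)))
      (w : ((K.cofacetGraph r).induce (S : Set (K.Face r))).Walk a b),
      K.hasseGraph.edist a.1.toSimplex b.1.toSimplex ≤ ((2 * w.length : ℕ) : ℕ∞) := by
    intro a b w
    induction w with
    | nil => simp
    | @cons a b c hab w ih =>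
      have hlen := SimpleGraph.Walk.length_cons hab w
      obtain ⟨u, hu, hu'⟩ := And.right hab
      have h₁ : K.hasseGraph.Adj a.1.toSimplex u.toSimplex := Or.inl (Face.isFacet_toSimplex hu)
      have h₂ : K.hasseGraph.Adj u.toSimplex b.1.toSimplex := Or.inr (Face.isFacet_toSimplex hu')
      have h₃ : K.hasseGraph.edist a.1.toSimplex b.1.toSimplex ≤ 2 :=
        SimpleGraph.edist_le (SimpleGraph.Walk.cons h₁ (SimpleGraph.Walk.cons h₂ .nil))
      refine (SimpleGraph.edist_triangle (v := b.1.toSimplex)).trans ((add_le_add h₃ ih).trans ?_)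
      rw [hlen]
      norm_cast
      omega
  obtain ⟨w⟩ := h.preconnected ⟨τ, hτ⟩ ⟨s, hs⟩
  have hlen := w.toPath.2.length_lt
  refine (hw _ _ w.toPath.1).trans ?_
  have : Fintype.card (S : Set (K.Face r)) = S.card := by simp
  rw [this] at hlen
  norm_cast
  omega

theorem IsHittingSet.exists_minimal_subset {K : AbstractSimplicialComplex V} {r : ℕ}
    {ζ : K.Chain r} {S : Finset (K.Face r)} (hS : K.IsHittingSet ζ S) :
    ∃ T ⊆ S, Minimal (K.IsHittingSet ζ) T :=
  exists_minimal_le_of_wellFoundedLT _ S hS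

theorem exists_isHittingSet_iff_exists_connected {K : AbstractSimplicialComplex V} {r : ℕ}
    {ζ : K.Chain r} (hζ : ζ ∈ K.cycles r) (k : ℕ) :
    (∃ S : Finset (K.Face r), S.card ≤ k ∧ K.IsHittingSet ζ S) ↔
      ∃ (τ : K.Face r) (S : Finset (K.Face r)),
        (∀ s ∈ S, s.toSimplex ∈ K.hasseBall τ.toSimplex (2 * k)) ∧
        K.InducesConnected S ∧ S.card ≤ k ∧ K.IsHittingSet ζ S := by
  constructor
  · rintro ⟨S, hk, hS⟩
    obtain ⟨T, hTS, hT⟩ := hS.exists_minimal_subset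
    have hTk := (Finset.card_le_card hTS).trans hk
    have hc := cofacetGraph_induce_connected hζ hT
    obtain ⟨τ, hτ⟩ := (isOddCocycle_of_minimal hζ hT).nonempty
    exact ⟨τ, T, fun s hs => mem_hasseBall_of_cofacetGraph hc hTk hτ hs,
      inducesConnected_of_cofacetGraph hc, hTk, hT.1⟩
  · rintro ⟨_, S, -, -, hk, hS⟩
    exact ⟨S, hk, hS⟩

end AbstractSimplicialComplex

/-! ### Bounded search for a smallest odd cocycle -/

namespace CocycleSearch

/-- The input of the search: the number `n` of simplices, which are represented by the numbers
below `n`, the budget `k`, the set `F u` of facets of each simplex `u`, the set `R` of candidates,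
and the support `Z` of the chain. -/
structure Data where
  n : ℕ
  k : ℕ
  F : ℕ → Finset ℕ
  R : Finset ℕ
  Z : Finset ℕ

/-- The state of the search: the stack of chosen candidates (last one first), the next candidate
to be tried, and the size and the members of the best solution found. -/
structure State where
  stack : List ℕ
  x : ℕ
  best : ℕ
  out : Finset ℕ
  running : Bool

variable (D : Data)

/-- `u + 1` for the last `u < i` with an odd number of facets in `Y`, or `0`. -/
def Data.pivot (Y : Finset ℕ) : ℕ → ℕ
  | 0 => 0
  | i + 1 => if (D.F i ∩ Y).card % 2 = 1 then i + 1 else Data.pivot Y i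

/-- `Y` is a cocycle whose value at `Z` is odd. -/
def Data.IsOdd (Y : Finset ℕ) : Prop :=
  D.pivot Y D.n = 0 ∧ (D.Z ∩ Y).card % 2 = 1

/-- The candidate `x` may be pushed on the stack `Y`. -/
def Data.Valid (Y : List ℕ) (x : ℕ) : Prop :=
  Y.length < D.k ∧ x ∈ D.R ∧ x ∉ Y ∧
    (Y = [] ∨ D.pivot Y.toFinset D.n ≠ 0 ∧ x ∈ D.F (D.pivot Y.toFinset D.n - 1))

instance (Y : Finset ℕ) : Decidable (D.IsOdd Y) := by unfold Data.IsOdd; infer_instance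

instance (Y : List ℕ) : DecidablePred (D.Valid Y) := fun x => by
  unfold Data.Valid; infer_instance

/-- Compare the current stack with the best solution found. -/
def Data.record (s : State) : State :=
  if D.IsOdd s.stack.toFinset ∧ s.stack.length < s.best then
    { s with best := s.stack.length, out := s.stack.toFinset }
  else s

/-- Move to the next node of the search tree. -/
def Data.advance (s : State) : State :=
  if s.x < D.n then
    if D.Valid s.stack s.x then { s with stack := s.x :: s.stack, x := 0 }
    else { s with x := s.x + 1 }
  else
    match s.stack with
    | [] => { s with running := false }
    -- Popping resumes just behind `y`, so each node tries every candidate once.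
    | y :: Y => { s with stack := Y, x := y + 1 }

/-- One step of the search. -/
def Data.step (s : State) : State := D.advance (D.record s)

/-- `s'` is reached from `s` in `N` steps. -/
inductive Data.Reach : ℕ → State → State → Prop
  | refl (s : State) : Reach 0 s s
  | step {N : ℕ} {s s' : State} (hs : s.running = true) (h : Reach N (D.step s) s') :
      Reach (N + 1) s s'

variable {D}

theorem Data.Reach.trans {N₁ N₂ : ℕ} {s₁ s₂ s₃ : State} (h₁ : D.Reach N₁ s₁ s₂)
    (h₂ : D.Reach N₂ s₂ s₃) : D.Reach (N₁ + N₂) s₁ s₃ := by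
  induction h₁ with
  | refl => simpa using h₂
  | step hs _ ih => rw [Nat.add_right_comm]; exact .step hs (ih h₂)

theorem Data.pivot_eq_zero {Y : Finset ℕ} {i : ℕ} :
    D.pivot Y i = 0 ↔ ∀ u < i, (D.F u ∩ Y).card % 2 = 0 := by
  induction i with
  | zero => simp [pivot]
  | succ i ih =>
    rw [pivot, Nat.forall_lt_succ_right]
    split_ifs with h
    · simp [h]
    · rw [ih]
      exact ⟨fun h' => ⟨h', by omega⟩, And.left⟩

theorem Data.pivot_spec {Y : Finset ℕ} {i : ℕ} (h : D.pivot Y i ≠ 0) :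
    D.pivot Y i - 1 < i ∧ (D.F (D.pivot Y i - 1) ∩ Y).card % 2 = 1 := by
  induction i with
  | zero => exact absurd rfl h
  | succ i ih =>
    rw [pivot] at h ⊢
    split_ifs at h ⊢ with h'
    · exact ⟨by simp, by simpa using h'⟩
    · exact ⟨(ih h).1.trans (Nat.lt_succ_self i), (ih h).2⟩

theorem Data.pivot_le (Y : Finset ℕ) (i : ℕ) : D.pivot Y i ≤ i := by
  by_cases h : D.pivot Y i = 0
  · omega
  · have := (pivot_spec h).1
    omega

theorem Data.IsOdd.nonempty {Y : Finset ℕ} (h : D.IsOdd Y) : Y.Nonempty := by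
  by_contra h'
  have := h.2
  simp [Finset.not_nonempty_iff_eq_empty.1 h'] at this

variable (D) in
/-- `T` is an odd cocycle of minimum size, and this size is within the budget. -/
structure Data.IsMinimum (T : Finset ℕ) : Prop where
  subset : T ⊆ D.R
  odd : D.IsOdd T
  card_le : T.card ≤ D.k
  min : ∀ T' ⊆ D.R, D.IsOdd T' → T.card ≤ T'.card

/-- Makes parities additive along `T = Y ∪ (T \ Y)`, so that `T \ Y` inherits evenness or oddness
from `T` and `Y`. -/
theorem card_inter_sdiff (A : Finset ℕ) {Y T : Finset ℕ} (h : Y ⊆ T) :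
    (A ∩ (T \ Y)).card + (A ∩ Y).card = (A ∩ T).card := by
  rw [← Finset.card_union_of_disjoint, ← Finset.inter_union_distrib_left,
    Finset.sdiff_union_of_subset h]
  exact (Finset.sdiff_disjoint.mono Finset.inter_subset_right Finset.inter_subset_right)

/-- A partial solution can be extended within a minimum solution. -/
theorem Data.IsMinimum.exists_valid {T : Finset ℕ} (hT : D.IsMinimum T) {Y : List ℕ}
    (hY : Y.Nodup) (hYT : Y.toFinset ⊂ T) : ∃ y ∈ T, D.Valid Y y := by
  have hcard := Finset.card_lt_card hYT
  have hlen : Y.length < D.k := by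
    rw [List.toFinset_card_of_nodup hY] at hcard
    exact hcard.trans_le hT.card_le
  obtain ⟨y, hyT, hyY⟩ := Finset.exists_of_ssubset hYT
  by_cases hnil : Y = []
  · exact ⟨y, hyT, hlen, hT.subset hyT, by simpa using hyY, Or.inl hnil⟩
  have hsub : Y.toFinset ⊆ D.R := hYT.1.trans hT.subset
  have hpos : 0 < Y.toFinset.card := by
    rw [List.toFinset_card_of_nodup hY]
    exact List.length_pos_of_ne_nil hnil
  have hT0 := Data.pivot_eq_zero.1 hT.odd.1
  -- A cocycle `Y` strictly inside `T` would contradict minimality: if odd, it is smaller than `T`;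
  -- if even, `T \ Y` is odd and, as `Y` is nonempty, smaller than `T`.
  have hpiv : D.pivot Y.toFinset D.n ≠ 0 := by
    intro h0
    by_cases hodd : (D.Z ∩ Y.toFinset).card % 2 = 1
    · exact absurd (hT.min _ hsub ⟨h0, hodd⟩) (by omega)
    · have h1 : D.IsOdd (T \ Y.toFinset) := by
        refine ⟨Data.pivot_eq_zero.2 fun u hu => ?_, ?_⟩
        · have h2 := card_inter_sdiff (D.F u) hYT.1
          have h3 := Data.pivot_eq_zero.1 h0 u hu
          have h4 := hT0 u hu
          omega
        · have h2 := card_inter_sdiff D.Z hYT.1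
          have h3 := hT.odd.2
          omega
      have h2 := hT.min _ (Finset.sdiff_subset.trans hT.subset) h1
      rw [Finset.card_sdiff_of_subset hYT.1] at h2
      omega
  obtain ⟨hu, hodd⟩ := Data.pivot_spec hpiv
  have heven := hT0 _ hu
  -- The pivot simplex has oddly many facets in `Y` and evenly many in `T`, so the two sets of
  -- facets differ.
  have hex : ∃ z ∈ D.F (D.pivot Y.toFinset D.n - 1) ∩ T, z ∉ Y.toFinset := by
    by_contra hcon
    push Not at hcon
    have : D.F (D.pivot Y.toFinset D.n - 1) ∩ T = D.F (D.pivot Y.toFinset D.n - 1) ∩ Y.toFinset :=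
      Finset.Subset.antisymm
        (fun z hz => Finset.mem_inter.2 ⟨(Finset.mem_inter.1 hz).1, hcon z hz⟩)
        (Finset.inter_subset_inter_left hYT.1)
    rw [this] at heven
    omega
  obtain ⟨z, hz, hzY⟩ := hex
  obtain ⟨hzF, hzT⟩ := Finset.mem_inter.1 hz
  exact ⟨z, hzT, hlen, hT.subset hzT, by simpa using hzY, Or.inr ⟨hpiv, hzF⟩⟩

variable (D) in
/-- The recorded solution is correct. -/
def Data.Sound (best : ℕ) (out : Finset ℕ) : Prop :=
  -- The value `D.k + 1` encodes that nothing has been found yet.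
  best ≤ D.k + 1 ∧ (best ≤ D.k → D.IsOdd out ∧ out.card = best ∧ out ⊆ D.R)

variable (D) in
/-- A bound for the number of steps spent below a node with `j` pushes left above it. -/
def Data.nodeBound (Δ : ℕ) : ℕ → ℕ
  | 0 => 0
  -- The candidate register moves across `n` values and one further step pops the node; each of at
  -- most `Δ` children adds its own subtree.
  | j + 1 => D.n + 1 + Δ * Data.nodeBound Δ j

theorem Data.nodeBound_le (Δ j : ℕ) : D.nodeBound Δ j ≤ (D.n + 1) * (Δ + 1) ^ j := by
  induction j with
  | zero => simp [nodeBound]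
  | succ j ih =>
    have h1 : 1 ≤ (Δ + 1) ^ j := Nat.one_le_pow _ _ (Nat.succ_pos _)
    calc D.n + 1 + Δ * D.nodeBound Δ j ≤ (D.n + 1) * (Δ + 1) ^ j + Δ * ((D.n + 1) * (Δ + 1) ^ j) :=
          add_le_add (Nat.le_mul_of_pos_right _ h1) (Nat.mul_le_mul_left _ ih)
      _ = _ := by ring

variable (D) in
/-- The candidates from `x` on that may be pushed on the stack `Y`. -/
def Data.children (Y : List ℕ) (x : ℕ) : Finset ℕ :=
  (Finset.Ico x D.n).filter (D.Valid Y)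

/-- Below the root only facets of the pivot simplex may be pushed; this is what bounds the branching
by `Δ` instead of `n`. -/
theorem Data.card_children_le {Δ : ℕ} (hΔ : ∀ u, (D.F u).card ≤ Δ) {Y : List ℕ} (hY : Y ≠ [])
    (x : ℕ) : (D.children Y x).card ≤ Δ := by
  refine (Finset.card_le_card fun y hy => ?_).trans (hΔ (D.pivot Y.toFinset D.n - 1))
  exact ((Finset.mem_filter.1 hy).2.2.2.2.resolve_left hY).2

theorem Data.card_children_of_valid {Y : List ℕ} {x : ℕ} (hx : x < D.n) (h : D.Valid Y x) :
    (D.children Y x).card = (D.children Y (x + 1)).card + 1 := by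
  rw [children, ← Finset.insert_Ico_add_one_left_eq_Ico hx, Finset.filter_insert, if_pos h,
    Finset.card_insert_of_notMem (by simp)]
  rfl

theorem Data.card_children_le_of_lt {Y : List ℕ} {x : ℕ} :
    (D.children Y (x + 1)).card ≤ (D.children Y x).card :=
  Finset.card_le_card
    (Finset.filter_subset_filter _ (Finset.Ico_subset_Ico_left (Nat.le_succ x)))

variable (D) in
/-- `best', out'` is at least as good as `best, out`. -/
structure Data.Improves (best : ℕ) (out : Finset ℕ) (best' : ℕ) (out' : Finset ℕ) : Prop where
  le : best' ≤ best
  sound : D.Sound best out → D.Sound best' out'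

theorem Data.Improves.trans {b₁ b₂ b₃ : ℕ} {o₁ o₂ o₃ : Finset ℕ} (h₁ : D.Improves b₁ o₁ b₂ o₂)
    (h₂ : D.Improves b₂ o₂ b₃ o₃) : D.Improves b₁ o₁ b₃ o₃ :=
  ⟨h₂.le.trans h₁.le, h₂.sound ∘ h₁.sound⟩

theorem Data.record_eq (Y : List ℕ) (hY : Y.Nodup) (hR : ∀ y ∈ Y, y ∈ D.R) (x best : ℕ)
    (out : Finset ℕ) (running : Bool) : ∃ best' out',
      D.record ⟨Y, x, best, out, running⟩ = ⟨Y, x, best', out', running⟩ ∧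
      D.Improves best out best' out' ∧ (D.IsOdd Y.toFinset → best' ≤ Y.length) := by
  unfold record
  split_ifs with h
  · refine ⟨_, _, rfl, ⟨h.2.le, fun hs => ⟨h.2.le.trans hs.1, fun _ => ⟨h.1, ?_, ?_⟩⟩⟩,
      fun _ => le_rfl⟩
    · exact List.toFinset_card_of_nodup hY
    · intro y hy
      exact hR y (List.mem_toFinset.1 hy)
  · exact ⟨_, _, rfl, ⟨le_rfl, id⟩, fun h' => not_lt.1 fun h'' => h ⟨h', h''⟩⟩

/-- All nodes of the search tree below a stack are visited. -/
theorem Data.exists_reach {Δ : ℕ} (hΔ : ∀ u, (D.F u).card ≤ Δ) (hRn : ∀ y ∈ D.R, y < D.n) :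
    ∀ (j : ℕ) (Y : List ℕ), Y.length + j = D.k → Y.Nodup → (∀ y ∈ Y, y ∈ D.R) →
    ∀ (i x : ℕ), x + i = D.n → ∀ (best : ℕ) (out : Finset ℕ), ∃ N best' out',
      D.Reach N ⟨Y, x, best, out, true⟩ ⟨Y, D.n, best', out', true⟩ ∧
      N ≤ i + (D.children Y x).card * D.nodeBound Δ j ∧ D.Improves best out best' out' ∧
      ∀ T, D.IsMinimum T → (Y.toFinset = T ∧ x < D.n) ∨
        (Y.toFinset ⊆ T ∧ ∃ y ∈ T, x ≤ y ∧ y < D.n ∧ D.Valid Y y) → best' ≤ T.card := by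
  -- Outer induction on the pushes left, inner induction on the candidates left. The case
  -- `Y.toFinset = T` asks for `x < D.n` because recording is part of a step, and a run starting at
  -- `x = D.n` is empty.
  intro j
  induction j with
  | zero =>
    intro Y hlen hnd hR i
    induction i with
    | zero =>
      intro x hx best out
      obtain rfl : x = D.n := by omega
      refine ⟨0, best, out, .refl _, by simp, ⟨le_rfl, id⟩, ?_⟩
      rintro T - (⟨-, h⟩ | ⟨-, y, -, h, h', -⟩) <;> omega
    | succ i ih =>
      intro x hx best out
      have hxn : x < D.n := by omega
      have hv : ∀ y, ¬ D.Valid Y y := fun y h => by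
        have := h.1
        omega
      obtain ⟨b₁, o₁, hrec, himp, hodd⟩ := D.record_eq Y hnd hR x best out true
      obtain ⟨N, b₂, o₂, hreach, hN, himp₂, -⟩ := ih (x + 1) (by omega) b₁ o₁
      have hstep : D.step ⟨Y, x, best, out, true⟩ = ⟨Y, x + 1, b₁, o₁, true⟩ := by
        simp only [step, hrec, advance, if_pos hxn, if_neg (hv x)]
      refine ⟨N + 1, b₂, o₂, .step rfl (hstep ▸ hreach), ?_, himp.trans himp₂, ?_⟩
      · simp only [nodeBound, mul_zero, add_zero] at hN ⊢
        omega
      · rintro T hT (⟨rfl, -⟩ | ⟨-, y, -, -, -, h⟩)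
        · rw [List.toFinset_card_of_nodup hnd]
          exact himp₂.le.trans (hodd hT.odd)
        · exact absurd h (hv y)
  | succ j ihj =>
    intro Y hlen hnd hR i
    induction i with
    | zero =>
      intro x hx best out
      obtain rfl : x = D.n := by omega
      refine ⟨0, best, out, .refl _, by simp, ⟨le_rfl, id⟩, ?_⟩
      rintro T - (⟨-, h⟩ | ⟨-, y, -, h, h', -⟩) <;> omega
    | succ i ih =>
      intro x hx best out
      have hxn : x < D.n := by omega
      obtain ⟨b₁, o₁, hrec, himp, hodd⟩ := D.record_eq Y hnd hR x best out true
      by_cases hv : D.Valid Y x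
      · have hstep : D.step ⟨Y, x, best, out, true⟩ = ⟨x :: Y, 0, b₁, o₁, true⟩ := by
          simp only [step, hrec, advance, if_pos hxn, if_pos hv]
        have hnd' : (x :: Y).Nodup := List.nodup_cons.2 ⟨hv.2.2.1, hnd⟩
        have hR' : ∀ y ∈ x :: Y, y ∈ D.R := by
          intro y hy
          rcases List.mem_cons.1 hy with rfl | hy
          · exact hv.2.1
          · exact hR y hy
        obtain ⟨N₂, b₂, o₂, hreach₂, hN₂, himp₂, hT₂⟩ :=
          ihj (x :: Y) (by rw [List.length_cons]; omega) hnd' hR' D.n 0 (zero_add _) b₁ o₁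
        obtain ⟨b₃, o₃, hrec₃, himp₃, -⟩ := D.record_eq (x :: Y) hnd' hR' D.n b₂ o₂ true
        have hstep₃ : D.step ⟨x :: Y, D.n, b₂, o₂, true⟩ = ⟨Y, x + 1, b₃, o₃, true⟩ := by
          simp only [step, hrec₃, advance, lt_irrefl, if_false]
        obtain ⟨N₄, b₄, o₄, hreach₄, hN₄, himp₄, hT₄⟩ := ih (x + 1) (by omega) b₃ o₃
        have h₃₄ : D.Reach (N₄ + 1) ⟨x :: Y, D.n, b₂, o₂, true⟩ ⟨Y, D.n, b₄, o₄, true⟩ :=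
          .step rfl (hstep₃ ▸ hreach₄)
        refine ⟨N₂ + (N₄ + 1) + 1, b₄, o₄, .step rfl (hstep ▸ hreach₂.trans h₃₄), ?_,
          ((himp.trans himp₂).trans himp₃).trans himp₄, ?_⟩
        · rw [D.card_children_of_valid hxn hv, add_mul, one_mul]
          -- The extra 1 is the pop of the child; the push is charged to the candidate `x` at the
          -- parent.
          have hN₂' : N₂ + 1 ≤ D.nodeBound Δ (j + 1) := by
            have := Nat.mul_le_mul_right (D.nodeBound Δ j)
              (D.card_children_le hΔ (List.cons_ne_nil x Y) 0)
            rw [nodeBound]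
            omega
          omega
        · rintro T hT (⟨rfl, -⟩ | ⟨hYT, y, hyT, hxy, hyn, hy⟩)
          · rw [List.toFinset_card_of_nodup hnd]
            exact (((himp₂.trans himp₃).trans himp₄).le).trans (hodd hT.odd)
          · rcases hxy.eq_or_lt with rfl | hlt
            -- The pushed candidate belongs to `T`: either the enlarged stack is `T` and gets
            -- recorded, or it extends further within `T`, which the outer induction covers.
            · refine (himp₃.trans himp₄).le.trans (hT₂ T hT ?_)
              have hsub : (x :: Y).toFinset ⊆ T := by
                rw [List.toFinset_cons]
                exact Finset.insert_subset hyT hYT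
              by_cases heq : (x :: Y).toFinset = T
              · exact Or.inl ⟨heq, by omega⟩
              · obtain ⟨z, hzT, hz⟩ := hT.exists_valid hnd' (hsub.ssubset_of_ne heq)
                refine Or.inr ⟨hsub, z, hzT, Nat.zero_le _, ?_, hz⟩
                exact hRn z (hT.subset hzT)
            · exact hT₄ T hT (Or.inr ⟨hYT, y, hyT, hlt, hyn, hy⟩)
      · have hstep : D.step ⟨Y, x, best, out, true⟩ = ⟨Y, x + 1, b₁, o₁, true⟩ := by
          simp only [step, hrec, advance, if_pos hxn, if_neg hv]
        obtain ⟨N, b₂, o₂, hreach, hN, himp₂, hT₂⟩ := ih (x + 1) (by omega) b₁ o₁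
        refine ⟨N + 1, b₂, o₂, .step rfl (hstep ▸ hreach), ?_, himp.trans himp₂, ?_⟩
        · have := Nat.mul_le_mul_right (D.nodeBound Δ (j + 1))
            (D.card_children_le_of_lt (Y := Y) (x := x))
          omega
        · rintro T hT (⟨rfl, -⟩ | ⟨hYT, y, hyT, hxy, hyn, hy⟩)
          · rw [List.toFinset_card_of_nodup hnd]
            exact himp₂.le.trans (hodd hT.odd)
          · rcases hxy.eq_or_lt with rfl | hlt
            · exact absurd hy hv
            · exact hT₂ T hT (Or.inr ⟨hYT, y, hyT, hlt, hyn, hy⟩)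

/-- The search started with the empty stack ends with a solution of minimum size. -/
theorem Data.exists_reach_final {Δ : ℕ} (hΔ : ∀ u, (D.F u).card ≤ Δ)
    (hRn : ∀ y ∈ D.R, y < D.n) : ∃ N best out,
      D.Reach N ⟨[], 0, D.k + 1, ∅, true⟩ ⟨[], D.n, best, out, false⟩ ∧
      N ≤ (D.n + 1) ^ 2 * (Δ + 1) ^ D.k ∧ D.Sound best out ∧
      ∀ T, D.IsMinimum T → best ≤ T.card := by
  obtain ⟨N, b, o, hreach, hN, himp, hT⟩ := Data.exists_reach hΔ hRn D.k [] (by simp)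
    List.nodup_nil (by simp) D.n 0 (zero_add _) (D.k + 1) ∅
  obtain ⟨b', o', hrec, himp', -⟩ := D.record_eq [] List.nodup_nil (by simp) D.n b o true
  have hstep : D.step ⟨[], D.n, b, o, true⟩ = ⟨[], D.n, b', o', false⟩ := by
    simp only [step, hrec, advance, lt_irrefl, if_false]
  refine ⟨N + 1, b', o', hreach.trans (.step rfl (hstep ▸ .refl _)), ?_,
    (himp.trans himp').sound ⟨le_rfl, fun h => absurd h (by omega)⟩, fun T hmin => ?_⟩
  -- The root has no pivot and may have `n` children, whence the second factor `n + 1`.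
  · have h₁ : (D.children [] 0).card ≤ D.n := by
      refine (Finset.card_filter_le _ _).trans ?_
      rw [Nat.card_Ico, Nat.sub_zero]
    have h₂ := Nat.mul_le_mul h₁ (D.nodeBound_le Δ D.k)
    have h₃ : 1 ≤ (Δ + 1) ^ D.k := Nat.one_le_pow _ _ (Nat.succ_pos _)
    calc N + 1 ≤ (D.n + 1) * 1 + D.n * ((D.n + 1) * (Δ + 1) ^ D.k) := by omega
      _ ≤ (D.n + 1) * (Δ + 1) ^ D.k + D.n * ((D.n + 1) * (Δ + 1) ^ D.k) := by gcongr
      _ = _ := by ring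
  · refine himp'.le.trans (hT T hmin (Or.inr ⟨by simp, ?_⟩))
    obtain ⟨y, hy, hv⟩ := hmin.exists_valid List.nodup_nil (by
      rw [List.toFinset_nil]
      exact Finset.empty_ssubset.2 hmin.odd.nonempty)
    exact ⟨y, hy, Nat.zero_le _, hRn y (hmin.subset hy), hv⟩

end CocycleSearch

/-! ### Reasoning about programs of the word RAM -/

namespace RAM

@[simp] theorem Store.reg_setReg (σ : Store) (x n y : ℕ) :
    (σ.setReg x n).reg y = if y = x then n else σ.reg y := by
  simp [Store.setReg, Function.update_apply]

@[simp] theorem Store.arr_setReg (σ : Store) (x n : ℕ) : (σ.setReg x n).arr = σ.arr := rfl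

@[simp] theorem Store.reg_setArr (σ : Store) (a i n : ℕ) : (σ.setArr a i n).reg = σ.reg := rfl

@[simp] theorem Store.arr_setArr (σ : Store) (a i n b j : ℕ) :
    (σ.setArr a i n).arr b j = if b = a ∧ j = i then n else σ.arr b j := by
  by_cases h : b = a
  · subst h
    simp [Store.setArr, Function.update_apply]
  · simp [Store.setArr, h]

/-- The registers a program assigns to. -/
def Cmd.regs : Cmd → List ℕ
  | skip => []
  | assign x _ => [x]
  | write _ _ _ => []
  | seq c₁ c₂ => c₁.regs ++ c₂.regs
  | branch _ c₁ c₂ => c₁.regs ++ c₂.regs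
  | loop _ c => c.regs

/-- The arrays a program writes to. -/
def Cmd.arrs : Cmd → List ℕ
  | skip => []
  | assign _ _ => []
  | write a _ _ => [a]
  | seq c₁ c₂ => c₁.arrs ++ c₂.arrs
  | branch _ c₁ c₂ => c₁.arrs ++ c₂.arrs
  | loop _ c => c.arrs

/-- The stores `σ` and `σ'` agree except where `c` writes. -/
structure Agree (c : Cmd) (σ σ' : Store) : Prop where
  reg : ∀ x ∉ c.regs, σ'.reg x = σ.reg x
  arr : ∀ a ∉ c.arrs, σ'.arr a = σ.arr a

theorem Agree.refl (c : Cmd) (σ : Store) : Agree c σ σ := ⟨fun _ _ => rfl, fun _ _ => rfl⟩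

theorem Agree.trans {c : Cmd} {σ₁ σ₂ σ₃ : Store} (h₁ : Agree c σ₁ σ₂) (h₂ : Agree c σ₂ σ₃) :
    Agree c σ₁ σ₃ :=
  ⟨fun x hx => (h₂.reg x hx).trans (h₁.reg x hx), fun a ha => (h₂.arr a ha).trans (h₁.arr a ha)⟩

theorem Agree.mono {c c' : Cmd} {σ σ' : Store} (h : Agree c σ σ') (hr : c.regs ⊆ c'.regs)
    (ha : c.arrs ⊆ c'.arrs) : Agree c' σ σ' :=
  ⟨fun x hx => h.reg x fun h' => hx (hr h'), fun a ha' => h.arr a fun h' => ha' (ha h')⟩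

/-- Frame rule: what a program does not mention as a target survives its run, so preservation of
registers and arrays reduces to a syntactic check. -/
theorem Run.agree {B : ℕ} {c : Cmd} {σ σ' : Store} {t : ℕ} (h : Run B c σ t σ') :
    Agree c σ σ' := by
  induction h with
  | skip => exact .refl _ _
  | assign x e σ h =>
    refine ⟨fun y hy => ?_, fun _ _ => rfl⟩
    simp only [Cmd.regs, List.mem_singleton] at hy
    simp [hy]
  | write a i e σ hi he =>
    refine ⟨fun _ _ => rfl, fun b hb => ?_⟩
    simp only [Cmd.arrs, List.mem_singleton] at hb
    funext j
    simp [hb]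
  | seq _ _ ih₁ ih₂ =>
    exact (ih₁.mono (List.subset_append_left _ _) (List.subset_append_left _ _)).trans
      (ih₂.mono (List.subset_append_right _ _) (List.subset_append_right _ _))
  | branch_true _ _ ih => exact ih.mono (List.subset_append_left _ _) (List.subset_append_left _ _)
  | branch_false _ _ ih =>
    exact ih.mono (List.subset_append_right _ _) (List.subset_append_right _ _)
  | loop_done => exact .refl _ _
  | loop_step _ _ _ ih₁ ih₂ => exact Agree.trans ⟨ih₁.reg, ih₁.arr⟩ ih₂

/-- Started in `σ`, the program `c` halts after at most `T` steps in a store satisfying `Q`. -/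
def Halts (B : ℕ) (c : Cmd) (T : ℕ) (σ : Store) (Q : Store → Prop) : Prop :=
  ∃ t σ', Run B c σ t σ' ∧ t ≤ T ∧ Q σ'

variable {B : ℕ}

theorem Halts.mono {c : Cmd} {T T' : ℕ} {σ : Store} {Q Q' : Store → Prop} (h : Halts B c T σ Q)
    (hT : T ≤ T') (hQ : ∀ σ', Agree c σ σ' → Q σ' → Q' σ') : Halts B c T' σ Q' := by
  obtain ⟨t, σ', hr, ht, hq⟩ := h
  exact ⟨t, σ', hr, ht.trans hT, hQ σ' hr.agree hq⟩

theorem Halts.skip {σ : Store} {Q : Store → Prop} (h : Q σ) : Halts B .skip 1 σ Q :=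
  ⟨1, σ, .skip σ, le_rfl, h⟩

theorem Halts.assign {x : ℕ} {e : Expr} {σ : Store} {Q : Store → Prop} (h : e.eval σ ≤ B)
    (hQ : Q (σ.setReg x (e.eval σ))) : Halts B (.assign x e) (e.cost + 1) σ Q :=
  ⟨_, _, .assign x e σ h, le_rfl, hQ⟩

theorem Halts.write {a : ℕ} {i e : Expr} {σ : Store} {Q : Store → Prop} (hi : i.eval σ ≤ B)
    (he : e.eval σ ≤ B) (hQ : Q (σ.setArr a (i.eval σ) (e.eval σ))) :
    Halts B (.write a i e) (i.cost + e.cost + 1) σ Q :=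
  ⟨_, _, .write a i e σ hi he, le_rfl, hQ⟩

theorem Halts.seq {c₁ c₂ : Cmd} {T₁ T₂ : ℕ} {σ : Store} {Q₁ Q : Store → Prop}
    (h₁ : Halts B c₁ T₁ σ Q₁) (h₂ : ∀ σ₁, Agree c₁ σ σ₁ → Q₁ σ₁ → Halts B c₂ T₂ σ₁ Q) :
    Halts B (.seq c₁ c₂) (T₁ + T₂) σ Q := by
  obtain ⟨t₁, σ₁, hr₁, ht₁, hq₁⟩ := h₁
  obtain ⟨t₂, σ₂, hr₂, ht₂, hq₂⟩ := h₂ σ₁ hr₁.agree hq₁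
  exact ⟨_, _, .seq hr₁ hr₂, add_le_add ht₁ ht₂, hq₂⟩

theorem Halts.assign_seq {x : ℕ} {e : Expr} {c : Cmd} {T : ℕ} {σ : Store} {Q : Store → Prop}
    (h : e.eval σ ≤ B) (h₂ : Halts B c T (σ.setReg x (e.eval σ)) Q) :
    Halts B (.seq (.assign x e) c) (e.cost + 1 + T) σ Q :=
  Halts.seq (Q₁ := fun σ' => σ' = σ.setReg x (e.eval σ)) (.assign h rfl)
    fun _ _ h => h ▸ h₂

theorem Halts.write_seq {a : ℕ} {i e : Expr} {c : Cmd} {T : ℕ} {σ : Store} {Q : Store → Prop}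
    (hi : i.eval σ ≤ B) (he : e.eval σ ≤ B)
    (h₂ : Halts B c T (σ.setArr a (i.eval σ) (e.eval σ)) Q) :
    Halts B (.seq (.write a i e) c) (i.cost + e.cost + 1 + T) σ Q :=
  Halts.seq (Q₁ := fun σ' => σ' = σ.setArr a (i.eval σ) (e.eval σ)) (.write hi he rfl)
    fun _ _ h => h ▸ h₂

theorem Halts.branch {e : Expr} {c₁ c₂ : Cmd} {T : ℕ} {σ : Store} {Q : Store → Prop}
    (h₁ : e.eval σ ≠ 0 → Halts B c₁ T σ Q) (h₂ : e.eval σ = 0 → Halts B c₂ T σ Q) :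
    Halts B (.branch e c₁ c₂) (e.cost + 1 + T) σ Q := by
  by_cases h : e.eval σ = 0
  · obtain ⟨t, σ', hr, ht, hq⟩ := h₂ h
    exact ⟨_, _, .branch_false h hr, Nat.add_le_add_left ht _, hq⟩
  · obtain ⟨t, σ', hr, ht, hq⟩ := h₁ h
    exact ⟨_, _, .branch_true h hr, Nat.add_le_add_left ht _, hq⟩

/-- Run `c` with register `i` ranging over all numbers below the content of register `N`. -/
def Cmd.forUp (i N : ℕ) (c : Cmd) : Cmd :=
  .seq (.assign i (.lit 0)) (.loop (.minus (.var N) (.var i))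
    (.seq c (.assign i (.plus (.var i) (.lit 1)))))

/-- Loop rule with invariant. Each round pays 4 for the test and 4 for the increment besides the
body; the outer 6 is the initial assignment and the failing test. The invariant is required after
the counter has been increased. -/
theorem Halts.forUp {i N : ℕ} {c : Cmd} {T n : ℕ} {σ : Store} (Inv : ℕ → Store → Prop)
    (hn : σ.reg N = n) (hB : n ≤ B) (hi : i ∉ c.regs) (hN : N ∉ (Cmd.forUp i N c).regs)
    (h0 : Inv 0 (σ.setReg i 0))
    (hc : ∀ j < n, ∀ σ', Agree (Cmd.forUp i N c) σ σ' → σ'.reg i = j → Inv j σ' →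
      Halts B c T σ' fun σ'' => Inv (j + 1) (σ''.setReg i (j + 1))) :
    Halts B (Cmd.forUp i N c) (n * (T + 8) + 6) σ (Inv n) := by
  have key : ∀ l j, j + l = n → ∀ σ', Agree (Cmd.forUp i N c) σ σ' → σ'.reg i = j → Inv j σ' →
      Halts B (.loop (.minus (.var N) (.var i)) (.seq c (.assign i (.plus (.var i) (.lit 1)))))
        (l * (T + 8) + 4) σ' (Inv n) := by
    intro l
    induction l with
    | zero =>
      intro j hj σ' hσ' hij hinv
      refine ⟨_, σ', .loop_done ?_, ?_, ?_⟩
      · simp only [Expr.eval, hσ'.reg N hN, hn, hij]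
        omega
      · simp [Expr.cost]
      · obtain rfl : j = n := by omega
        exact hinv
    | succ l ih =>
      intro j hj σ' hσ' hij hinv
      obtain ⟨t, σ₁, hr, ht, hq⟩ := hc j (by omega) σ' hσ' hij hinv
      have hreg : σ₁.reg i = j := (hr.agree.reg i hi).trans hij
      have hev : (Expr.plus (.var i) (.lit 1)).eval σ₁ = j + 1 := by simp [Expr.eval, hreg]
      have hr₂ : Run B (.seq c (.assign i (.plus (.var i) (.lit 1)))) σ' (t + 4)
          (σ₁.setReg i (j + 1)) := by
        have := Run.assign (B := B) i (Expr.plus (.var i) (.lit 1)) σ₁ (by rw [hev]; omega)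
        rw [hev] at this
        exact Run.seq hr this
      have hagree : Agree (Cmd.forUp i N c) σ' (σ₁.setReg i (j + 1)) :=
        hr₂.agree.mono (by simp [Cmd.forUp, Cmd.regs]) (by simp [Cmd.forUp, Cmd.arrs])
      obtain ⟨t', σ₂, hr', ht', hq'⟩ := ih (j + 1) (by omega) _ (hσ'.trans hagree)
        (by simp) hq
      refine ⟨_, σ₂, .loop_step ?_ hr₂ hr', ?_, hq'⟩
      · simp only [Expr.eval, hσ'.reg N hN, hn, hij]
        omega
      · simp only [Expr.cost, add_mul, one_mul]
        omega
  have h0' : Run B (.assign i (.lit 0)) σ 2 (σ.setReg i 0) :=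
    Run.assign i (.lit 0) σ (Nat.zero_le _)
  obtain ⟨t, σ', hr, ht, hq⟩ := key n 0 (zero_add n) (σ.setReg i 0)
    (h0'.agree.mono (by simp [Cmd.forUp, Cmd.regs]) (by simp [Cmd.forUp, Cmd.arrs])) (by simp) h0
  exact ⟨_, _, .seq h0' hr, by omega, hq⟩

end RAM

/-! ### The search as a program of the word RAM

Registers 0, 1, 2, 3 hold the numbers of simplices and of vertices, the dimension and the budget;
7 and 8 hold the pivot and the parity of the current stack, 9 its height, 10 the next candidate,
11 the size of the best solution, 12 tells whether the search is running, and 4, 5, 6 are scratch.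
Array 2 marks the best solution, array 3 holds the cardinalities of the simplices, array 4 the
facet relation, array 5 the stack, array 6 marks its members, and array 7 marks the candidates. -/

namespace CocycleSearch

open RAM

/-- The sum modulo two of two bits. -/
def toggle (p b : Expr) : Expr :=
  .minus (.plus p b) (.times (.lit 2) (.times p b))

theorem eval_toggle {σ : Store} {p b : Expr} {S : ℕ} (hp : p.eval σ = S % 2)
    (hb : b.eval σ ≤ 1) : (toggle p b).eval σ = (S + b.eval σ) % 2 := by
  simp only [toggle, Expr.eval, hp]
  have h := Nat.mod_two_eq_zero_or_one S
  generalize b.eval σ = x at *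
  interval_cases x <;> rcases h with h | h <;> simp [h] <;> omega

/-- Store the parity of the sum of all values of `e` in register `q`. -/
def parityProg (q : ℕ) (e : Expr) : Cmd :=
  .seq (.assign q (.lit 0)) (.forUp 5 0 (.assign q (toggle (.var q) e)))

/-- The cost of `e` counts twice because `toggle` evaluates its second argument twice. -/
theorem halts_parityProg {B n q : ℕ} {e : Expr} {σ : Store} (g : ℕ → ℕ) (hn : σ.reg 0 = n)
    (hB : n ≤ B) (_ : 1 ≤ B) (hq : q ≠ 0 ∧ q ≠ 5) (hg : ∀ y < n, g y ≤ 1)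
    (he : ∀ y < n, ∀ σ', Agree (parityProg q e) σ σ' → σ'.reg 5 = y → e.eval σ' = g y) :
    Halts B (parityProg q e) (n * (2 * e.cost + 16) + 8) σ
      (fun σ' => σ'.reg q = (∑ y ∈ Finset.range n, g y) % 2) := by
  refine Halts.mono (Halts.assign_seq (Nat.zero_le _) (Halts.forUp (T := 2 * e.cost + 8) (n := n)
    (fun j σ' => σ'.reg q = (∑ y ∈ Finset.range j, g y) % 2) ?_ hB ?_ ?_ ?_ ?_)) ?_
    fun σ' _ h => h
  · simpa [hq.1.symm] using hn
  · simp [Cmd.regs, hq.2.symm]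
  · simp [Cmd.regs, Cmd.forUp, hq.1.symm]
  · simp [hq.2, Expr.eval]
  · intro j hj σ' hσ' h5 hinv
    have hev : e.eval σ' = g j := by
      refine he j hj σ' (Agree.trans (σ₂ := σ.setReg q 0) ⟨fun x hx => ?_, fun _ _ => rfl⟩
        (hσ'.mono (List.subset_append_right _ _) (List.subset_append_right _ _))) h5
      simp only [parityProg, Cmd.regs, List.mem_append, List.mem_singleton, not_or] at hx
      simp [hx.1]
    have ht := eval_toggle (p := .var q) hinv (by rw [hev]; exact hg j hj)
    refine Halts.mono (Halts.assign ?_ ?_) (T := (toggle (.var q) e).cost + 1)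
      (Q := fun σ'' => σ''.reg q = (∑ y ∈ Finset.range (j + 1), g y) % 2) ?_ ?_
    · rw [ht]
      have := Nat.mod_lt (∑ y ∈ Finset.range j, g y + e.eval σ') Nat.two_pos
      omega
    · rw [ht, hev, Finset.sum_range_succ]
      simp
    · simp only [toggle, Expr.cost]
      omega
    · intro σ'' _ h
      simpa [hq.2] using h
  · simp only [Expr.cost]
    ring_nf
    omega

/-- The entry of the facet relation for the simplices `u` and `y`. -/
def facetEntry (u y : Expr) : Expr := .read 4 (.plus (.times u (.var 0)) y)

/-- Compute the pivot and the parity of the current stack. -/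
def analyzeProg : Cmd :=
  .seq (.assign 7 (.lit 0)) (.seq
    -- Overwriting register 7 during an upward scan leaves the last odd simplex, in agreement with
    -- `Data.pivot`.
    (.forUp 4 0 (.seq (parityProg 6 (.times (facetEntry (.var 4) (.var 5)) (.read 6 (.var 5))))
      (.branch (.var 6) (.assign 7 (.plus (.var 4) (.lit 1))) .skip)))
    (parityProg 8 (.times (.read 1 (.var 5)) (.read 6 (.var 5)))))

/-- Record the stack if it is the best solution so far. -/
def recordProg : Cmd :=
  .branch (.times (.minus (.lit 1) (.var 7)) (.times (.var 8) (.minus (.var 11) (.var 9))))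
    (.seq (.assign 11 (.var 9)) (.forUp 5 0 (.write 2 (.var 5) (.read 6 (.var 5)))))
    .skip

/-- A test whether the candidate may be pushed on the stack. -/
def validExpr : Expr :=
  -- Products act as conjunctions, the sum as a disjunction, truncated differences as strict
  -- comparisons or negations; `1 -` register 9 tests for the empty stack.
  .times (.minus (.var 3) (.var 9)) (.times (.read 7 (.var 10))
    (.times (.minus (.lit 1) (.read 6 (.var 10)))
      (.plus (.minus (.lit 1) (.var 9))
        (.times (.var 7) (facetEntry (.minus (.var 7) (.lit 1)) (.var 10))))))

/-- Move to the next node of the search tree. -/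
def advanceProg : Cmd :=
  .branch (.minus (.var 0) (.var 10))
    (.branch validExpr
      (.seq (.write 5 (.var 9) (.var 10)) (.seq (.write 6 (.var 10) (.lit 1))
        (.seq (.assign 9 (.plus (.var 9) (.lit 1))) (.assign 10 (.lit 0)))))
      (.assign 10 (.plus (.var 10) (.lit 1))))
    (.branch (.var 9)
      (.seq (.assign 9 (.minus (.var 9) (.lit 1))) (.seq (.assign 10 (.read 5 (.var 9)))
        (.seq (.write 6 (.var 10) (.lit 0)) (.assign 10 (.plus (.var 10) (.lit 1))))))
      (.assign 12 (.lit 0)))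

/-- One step of the search. -/
def stepProg : Cmd := .seq analyzeProg (.seq recordProg advanceProg)

/-- The array `f` holds the stack `Y`. -/
def HoldsStack (f : ℕ → ℕ) : List ℕ → Prop
  | [] => True
  | y :: Y => f Y.length = y ∧ HoldsStack f Y

theorem HoldsStack.congr {f g : ℕ → ℕ} {Y : List ℕ} (h : HoldsStack f Y)
    (hfg : ∀ i < Y.length, g i = f i) : HoldsStack g Y := by
  induction Y with
  | nil => trivial
  | cons y Y ih =>
    exact ⟨(hfg _ (Nat.lt_succ_self _)).trans h.1, ih h.2 fun i hi => hfg i (Nat.lt_succ_of_lt hi)⟩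

/-- The sets of the data consist of numbers below `n`. -/
structure Data.Bounded (D : Data) : Prop where
  F : ∀ u, D.F u ⊆ Finset.range D.n
  R : D.R ⊆ Finset.range D.n
  Z : D.Z ⊆ Finset.range D.n

/-- The store `σ` holds the data `D`. -/
structure HoldsData (D : Data) (σ : Store) : Prop where
  n : σ.reg 0 = D.n
  k : σ.reg 3 = D.k
  F : ∀ u < D.n, ∀ y < D.n, σ.arr 4 (u * D.n + y) = if y ∈ D.F u then 1 else 0
  R : ∀ y < D.n, σ.arr 7 y = if y ∈ D.R then 1 else 0
  Z : ∀ y < D.n, σ.arr 1 y = if y ∈ D.Z then 1 else 0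

/-- The store `σ` holds the data `D` and the state `s` of the search. -/
structure Holds (D : Data) (s : State) (σ : Store) : Prop extends HoldsData D σ where
  len : σ.reg 9 = s.stack.length
  x : σ.reg 10 = s.x
  best : σ.reg 11 = s.best
  running : σ.reg 12 = if s.running then 1 else 0
  stack : HoldsStack (σ.arr 5) s.stack
  mem : ∀ y, σ.arr 6 y = if y ∈ s.stack then 1 else 0
  out : ∀ y < D.n, σ.arr 2 y = if y ∈ s.out then 1 else 0
  nodup : s.stack.Nodup
  len_le : s.stack.length ≤ D.k
  lt : ∀ y ∈ s.stack, y < D.n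
  x_le : s.x ≤ D.n

/-! ### Simulation of one search step by the program. -/

theorem sum_indicator {n : ℕ} {A : Finset ℕ} (hA : A ⊆ Finset.range n) (Y : List ℕ) :
    ∑ y ∈ Finset.range n, (if y ∈ A then 1 else 0) * (if y ∈ Y then 1 else 0) =
      (A ∩ Y.toFinset).card := by
  have : A ∩ Y.toFinset = (Finset.range n).filter fun y => y ∈ A ∧ y ∈ Y := by
    ext y
    have := @hA y
    simp only [Finset.mem_inter, List.mem_toFinset, Finset.mem_filter]
    tauto
  rw [this, Finset.card_filter]
  refine Finset.sum_congr rfl fun y _ => ?_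
  by_cases h₁ : y ∈ A <;> by_cases h₂ : y ∈ Y <;> simp [h₁, h₂]

theorem halts_analyzeProg {B : ℕ} {D : Data} {s : State} {σ : Store} (hD : D.Bounded)
    (h : Holds D s σ) (hB : D.n + 1 ≤ B) :
    Halts B analyzeProg ((D.n + 1) * (D.n + 1) * 100) σ (fun σ' =>
      σ'.reg 7 = D.pivot s.stack.toFinset D.n ∧
      σ'.reg 8 = (D.Z ∩ s.stack.toFinset).card % 2) := by
  refine Halts.mono (Halts.assign_seq (Nat.zero_le _) (Halts.seq
    (Halts.forUp (T := D.n * 36 + 14) (n := D.n)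
      (fun j σ' => σ'.reg 7 = D.pivot s.stack.toFinset j) ?_ (by omega) ?_ ?_ ?_ ?_)
    fun σ₁ hσ₁ h₁ => Halts.mono (halts_parityProg (n := D.n)
      (fun y => (if y ∈ D.Z then 1 else 0) * (if y ∈ s.stack then 1 else 0)) ?_ (by omega)
      (by omega) (by decide) ?_ ?_) le_rfl fun σ₂ hσ₂ h₂ => ⟨?_, ?_⟩)) ?_ fun σ' _ h => h
  · simpa using h.n
  · decide
  · decide
  · simp [Expr.eval, Data.pivot]
  · intro j hj σ' hσ' h4 hinv
    have h0 : σ'.reg 0 = D.n := (hσ'.reg 0 (by decide)).trans (by simpa using h.n)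
    have ha4 : σ'.arr 4 = σ.arr 4 := hσ'.arr 4 (by decide)
    have ha6 : σ'.arr 6 = σ.arr 6 := hσ'.arr 6 (by decide)
    refine Halts.mono (Halts.seq (halts_parityProg (n := D.n)
      (fun y => (if y ∈ D.F j then 1 else 0) * (if y ∈ s.stack then 1 else 0)) h0 (by omega)
      (by omega) (by decide) ?_ ?_) fun σ₁ hσ₁ h₁ => Halts.branch (T := 4)
      (Q := fun σ'' => σ''.reg 7 = D.pivot s.stack.toFinset (j + 1)) ?_ ?_) ?_ ?_
    · intro y _
      split_ifs <;> simp
    · intro y hy σ₁ hσ₁ h5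
      have e0 : σ₁.reg 0 = D.n := (hσ₁.reg 0 (by decide)).trans h0
      have e4 : σ₁.reg 4 = j := (hσ₁.reg 4 (by decide)).trans h4
      have a4 : σ₁.arr 4 = σ.arr 4 := (hσ₁.arr 4 (by decide)).trans ha4
      have a6 : σ₁.arr 6 = σ.arr 6 := (hσ₁.arr 6 (by decide)).trans ha6
      simp only [facetEntry, Expr.eval, e0, e4, a4, a6, h5, h.F j hj y hy, h.mem]
    · intro hne
      rw [sum_indicator (hD.F j)] at h₁
      refine Halts.assign ?_ ?_
      · simp only [Expr.eval, hσ₁.reg 4 (by decide), h4]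
        omega
      · simp only [Expr.eval, h₁] at hne
        simp only [Expr.eval, Store.reg_setReg, if_true, hσ₁.reg 4 (by decide), h4, Data.pivot]
        rw [if_pos (by omega)]
    · intro heq
      rw [sum_indicator (hD.F j)] at h₁
      refine Halts.mono (Halts.skip (Q := fun σ'' => σ''.reg 7 = D.pivot s.stack.toFinset (j + 1))
        ?_) (by omega) fun _ _ h => h
      simp only [Expr.eval, h₁] at heq
      rw [hσ₁.reg 7 (by decide), hinv, Data.pivot, if_neg (by omega)]
    · simp only [facetEntry, Expr.cost]
      omega
    · intro σ'' _ h''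
      simpa using h''
  · simpa using (hσ₁.reg 0 (by decide)).trans (by simpa using h.n)
  · intro y _
    split_ifs <;> simp
  · intro y hy σ₂ hσ₂ h5
    have a1 : σ₂.arr 1 = σ.arr 1 := (hσ₂.arr 1 (by decide)).trans (hσ₁.arr 1 (by decide))
    have a6 : σ₂.arr 6 = σ.arr 6 := (hσ₂.arr 6 (by decide)).trans (hσ₁.arr 6 (by decide))
    simp only [Expr.eval, a1, a6, h5, h.Z y hy, h.mem]
  · simp only [Expr.cost]
    ring_nf
    nlinarith
  · rw [hσ₂.reg 7 (by decide), h₁]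
  · rw [h₂, sum_indicator hD.Z]

end CocycleSearch

namespace CocycleSearch

open RAM

@[simp] theorem Data.record_stack (D : Data) (s : State) : (D.record s).stack = s.stack := by
  unfold record; split_ifs <;> rfl

@[simp] theorem Data.record_running (D : Data) (s : State) :
    (D.record s).running = s.running := by
  unfold record; split_ifs <;> rfl

theorem halts_recordProg {B : ℕ} {D : Data} {s : State} {σ : Store} (h : Holds D s σ)
    (h7 : σ.reg 7 = D.pivot s.stack.toFinset D.n)
    (h8 : σ.reg 8 = (D.Z ∩ s.stack.toFinset).card % 2) (hB : D.n + D.k + 1 ≤ B) :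
    Halts B recordProg ((D.n + 1) * 40) σ (Holds D (D.record s)) := by
  have hlen := h.len_le
  have hcond : (Expr.times (.minus (.lit 1) (.var 7))
      (.times (.var 8) (.minus (.var 11) (.var 9)))).eval σ ≠ 0 ↔
      D.IsOdd s.stack.toFinset ∧ s.stack.length < s.best := by
    simp only [Expr.eval, h7, h8, h.best, h.len, Data.IsOdd, mul_ne_zero_iff]
    omega
  refine Halts.mono (Halts.branch (T := D.n * 13 + 8) (Q := Holds D (D.record s)) ?_ ?_) ?_
    fun _ _ h => h
  · intro hne
    rw [Data.record, if_pos (hcond.1 hne)]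
    refine Halts.mono (Halts.assign_seq ?_ (Halts.mono (Halts.forUp (T := 4) (n := D.n)
      (fun j σ' => ∀ y < j, σ'.arr 2 y = if y ∈ s.stack then 1 else 0) ?_ (by omega) ?_ ?_ ?_ ?_)
      le_rfl fun σ' hσ' hinv => ?_)) (Q := Holds D ⟨s.stack, s.x, s.stack.length,
        s.stack.toFinset, s.running⟩) ?_ fun _ _ h => h
    · simp only [Expr.eval, h.len]
      omega
    · simpa using h.n
    · decide
    · decide
    · simp
    · intro j hj σ' hσ' h5 hinv
      have a6 : σ'.arr 6 = σ.arr 6 := hσ'.arr 6 (by decide)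
      refine Halts.write ?_ ?_ ?_
      · simp only [Expr.eval, h5]
        omega
      · simp only [Expr.eval, h5, a6, h.mem]
        split_ifs <;> omega
      · intro y hy
        simp only [Expr.eval, h5, a6, h.mem, Store.arr_setReg, Store.arr_setArr, true_and]
        by_cases hyj : y = j
        · rw [if_pos hyj, hyj]
        · rw [if_neg hyj]
          exact hinv y (by omega)
    · have r : ∀ x, x ≠ 5 → x ≠ 11 → σ'.reg x = σ.reg x := fun x h₁ h₂ =>
        (hσ'.reg x (by simp [Cmd.regs, Cmd.forUp, h₁])).trans (by simp [h₂])
      have a : ∀ x, x ≠ 2 → σ'.arr x = σ.arr x := fun x h₁ =>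
        hσ'.arr x (by simp [Cmd.arrs, Cmd.forUp, h₁])
      have e11 : σ'.reg 11 = s.stack.length := by
        rw [hσ'.reg 11 (by decide)]
        simp [Expr.eval, h.len]
      exact {
        n := (r 0 (by decide) (by decide)).trans h.n
        k := (r 3 (by decide) (by decide)).trans h.k
        F := by rw [a 4 (by decide)]; exact h.F
        R := by rw [a 7 (by decide)]; exact h.R
        Z := by rw [a 1 (by decide)]; exact h.Z
        len := (r 9 (by decide) (by decide)).trans h.len
        x := (r 10 (by decide) (by decide)).trans h.x
        best := e11
        running := (r 12 (by decide) (by decide)).trans h.running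
        stack := by rw [a 5 (by decide)]; exact h.stack
        mem := by rw [a 6 (by decide)]; exact h.mem
        out := fun y hy => by rw [hinv y hy]; simp
        nodup := h.nodup
        len_le := h.len_le
        lt := h.lt
        x_le := h.x_le }
    · simp only [Expr.cost]
      omega
  · intro heq
    rw [Data.record, if_neg fun h' => hcond.2 h' heq]
    exact Halts.mono (Halts.skip h) (by omega) fun _ _ h => h
  · simp only [Expr.cost]
    omega

theorem validExpr_eval_ne_zero {D : Data} {s : State} {σ : Store} (h : Holds D s σ)
    (h7 : σ.reg 7 = D.pivot s.stack.toFinset D.n) (hx : s.x < D.n) :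
    validExpr.eval σ ≠ 0 ↔ D.Valid s.stack s.x := by
  have hnil : s.stack.length = 0 ↔ s.stack = [] := List.length_eq_zero_iff
  have hple := D.pivot_le s.stack.toFinset D.n
  have hind : ∀ p : Prop, [Decidable p] → ((if p then 1 else 0 : ℕ) ≠ 0 ↔ p) := by
    intro p _
    split_ifs <;> simp_all
  have hind' : ∀ p : Prop, [Decidable p] → (1 - (if p then 1 else 0 : ℕ) ≠ 0 ↔ ¬ p) := by
    intro p _
    split_ifs <;> simp_all
  simp only [validExpr, facetEntry, Expr.eval, h.k, h.len, h.x, h.n, h7, h.R _ hx, h.mem,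
    Data.Valid, mul_ne_zero_iff, hind, hind']
  refine and_congr (by omega) (and_congr Iff.rfl (and_congr Iff.rfl ?_))
  rw [← hnil]
  -- For pivot zero the truncated `0 - 1` addresses an irrelevant row of the facet table, but the
  -- factor zero discards that entry.
  by_cases h0 : D.pivot s.stack.toFinset D.n = 0
  · simp only [h0, zero_mul, ne_eq, not_true, false_and, or_false]
    omega
  · rw [h.F _ (by omega) _ hx]
    by_cases hF : s.x ∈ D.F (D.pivot s.stack.toFinset D.n - 1)
    · simp only [hF, if_true, ne_eq, h0, not_false_eq_true, and_self, or_true, iff_true]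
      omega
    · simp only [hF, if_false, mul_zero, and_false, or_false]
      omega

theorem halts_advanceProg {B : ℕ} {D : Data} {s : State} {σ : Store}
    (h : Holds D s σ)
    (h7 : σ.reg 7 = D.pivot s.stack.toFinset D.n) (hB : D.n + D.k + 1 ≤ B) :
    Halts B advanceProg 100 σ (Holds D (D.advance s)) := by
  have hlen := h.len_le
  have hxle := h.x_le
  refine Halts.mono (Halts.branch (T := 60) (Q := Holds D (D.advance s)) ?_ ?_) (by decide)
    fun _ _ h => h
  · intro hne
    have hx : s.x < D.n := by
      simp only [Expr.eval, h.n, h.x] at hne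
      omega
    have hcond := validExpr_eval_ne_zero h h7 hx
    refine Halts.mono (Halts.branch (T := 20) (Q := Holds D (D.advance s)) ?_ ?_) (by decide)
      fun _ _ h => h
    · intro hv
      have hvalid := hcond.1 hv
      rw [Data.advance, if_pos hx, if_pos hvalid]
      have hlt := hvalid.1
      refine Halts.mono (Halts.write_seq ?_ ?_ (Halts.write_seq ?_ ?_ (Halts.assign_seq ?_
        (Halts.assign ?_ ?_)))) (Q := Holds D ⟨s.x :: s.stack, 0, s.best, s.out, s.running⟩)
        (by decide) fun _ _ h => h
      all_goals simp only [Expr.eval, Store.reg_setArr, h.len, h.x]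
      any_goals omega
      exact {
        n := by simpa using h.n
        k := by simpa using h.k
        F := by simpa using h.F
        R := by simpa using h.R
        Z := by simpa using h.Z
        len := by simp
        x := by simp
        best := by simpa using h.best
        running := by simpa using h.running
        stack := ⟨by simp, h.stack.congr fun i hi => by simp [hi.ne]⟩
        mem := fun y => by by_cases hy : y = s.x <;> simp [hy, h.mem]
        out := by simpa using h.out
        nodup := List.nodup_cons.2 ⟨hvalid.2.2.1, h.nodup⟩
        len_le := hlt
        lt := fun y hy => by
          rcases List.mem_cons.1 hy with rfl | hy
          · exact hx
          · exact h.lt y hy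
        x_le := Nat.zero_le _ }
    · intro hv
      have hvalid : ¬ D.Valid s.stack s.x := fun h' => hcond.2 h' hv
      rw [Data.advance, if_pos hx, if_neg hvalid]
      refine Halts.mono (Halts.assign ?_ ?_)
        (Q := Holds D ⟨s.stack, s.x + 1, s.best, s.out, s.running⟩)
        (by decide) fun _ _ h => h
      · simp only [Expr.eval, h.x]
        omega
      · exact {
          n := by simpa using h.n
          k := by simpa using h.k
          F := h.F
          R := h.R
          Z := h.Z
          len := by simpa using h.len
          x := by simp [Expr.eval, h.x]
          best := by simpa using h.best
          running := by simpa using h.running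
          stack := h.stack
          mem := h.mem
          out := h.out
          nodup := h.nodup
          len_le := h.len_le
          lt := h.lt
          x_le := hx }
  · intro heq
    have hx : ¬ s.x < D.n := by
      simp only [Expr.eval, h.n, h.x] at heq
      omega
    rw [Data.advance, if_neg hx]
    refine Halts.branch (T := 50) ?_ ?_ |>.mono (by decide) fun _ _ h => h
    · intro hne
      simp only [Expr.eval, h.len] at hne
      obtain ⟨Y, x, best, out, running⟩ := s
      cases Y with
      | nil => exact absurd rfl hne
      | cons y Y =>
        have hy : y < D.n := h.lt y List.mem_cons_self
        have h9 : σ.reg 9 = Y.length + 1 := h.len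
        have h5 : σ.arr 5 Y.length = y := h.stack.1
        have hlen' : Y.length + 1 ≤ D.k := hlen
        have hnd := List.nodup_cons.1 h.nodup
        refine Halts.mono (Halts.assign_seq ?_ (Halts.assign_seq ?_ (Halts.write_seq ?_ ?_
          (Halts.assign ?_ ?_)))) (Q := Holds D ⟨Y, y + 1, best, out, running⟩)
          (by decide) fun _ _ h => h
        all_goals simp only [Expr.eval, Store.reg_setReg, Store.reg_setArr, Store.arr_setReg, h9,
          if_true, Nat.add_sub_cancel, h5]
        any_goals omega
        exact {
          n := by simpa using h.n
          k := by simpa using h.k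
          F := by simpa using h.F
          R := by simpa using h.R
          Z := by simpa using h.Z
          len := by simp
          x := by simp
          best := by simpa using h.best
          running := by simpa using h.running
          stack := h.stack.2.congr fun i hi => by simp
          mem := fun z => by
            by_cases hz : z = y
            · simp [hz, hnd.1]
            · simp [hz, h.mem]
          out := by simpa using h.out
          nodup := hnd.2
          len_le := (Nat.le_succ _).trans hlen'
          lt := fun z hz => h.lt z (List.mem_cons_of_mem _ hz)
          x_le := hy }
    · intro heq
      simp only [Expr.eval, h.len, List.length_eq_zero_iff] at heq
      rw [heq]
      refine Halts.mono (Halts.assign (Nat.zero_le _) ?_)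
        (Q := Holds D ⟨[], s.x, s.best, s.out, false⟩) (by decide) fun _ _ h => ?_
      · exact {
          n := by simpa using h.n
          k := by simpa using h.k
          F := h.F
          R := h.R
          Z := h.Z
          len := by simpa [heq] using h.len
          x := by simpa using h.x
          best := by simpa using h.best
          running := by simp [Expr.eval]
          stack := trivial
          mem := by simpa [heq] using h.mem
          out := h.out
          nodup := List.nodup_nil
          len_le := Nat.zero_le _
          lt := by simp
          x_le := h.x_le }
      · simpa [heq] using h

end CocycleSearch

namespace CocycleSearch

open RAM

theorem halts_stepProg {B : ℕ} {D : Data} {s : State} {σ : Store} (hD : D.Bounded)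
    (h : Holds D s σ) (hB : D.n + D.k + 1 ≤ B) :
    Halts B stepProg ((D.n + 1) * (D.n + 1) * 240) σ (Holds D (D.step s)) := by
  refine Halts.mono (Halts.seq (halts_analyzeProg hD h (by omega)) fun σ₁ hσ₁ h₁ => Halts.seq
    (halts_recordProg (s := s) ?_ h₁.1 h₁.2 hB) fun σ₂ hσ₂ h₂ => halts_advanceProg h₂ ?_ hB)
    (by nlinarith) fun _ _ h => h
  -- The analysis writes only registers 4 to 8 and no array, none of which encodes the search state.
  · have r : ∀ x, x ∉ [4, 5, 6, 7, 8] → σ₁.reg x = σ.reg x := fun x hx => hσ₁.reg x (by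
      simp only [List.mem_cons, List.not_mem_nil, or_false, not_or] at hx
      simp [analyzeProg, parityProg, Cmd.forUp, Cmd.regs, hx])
    have a : ∀ x, σ₁.arr x = σ.arr x := fun x =>
      hσ₁.arr x (by simp [analyzeProg, parityProg, Cmd.forUp, Cmd.arrs])
    exact {
      n := (r 0 (by decide)).trans h.n
      k := (r 3 (by decide)).trans h.k
      F := by rw [a]; exact h.F
      R := by rw [a]; exact h.R
      Z := by rw [a]; exact h.Z
      len := (r 9 (by decide)).trans h.len
      x := (r 10 (by decide)).trans h.x
      best := (r 11 (by decide)).trans h.best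
      running := (r 12 (by decide)).trans h.running
      stack := by rw [a]; exact h.stack
      mem := by rw [a]; exact h.mem
      out := by rw [a]; exact h.out
      nodup := h.nodup
      len_le := h.len_le
      lt := h.lt
      x_le := h.x_le }
  · rw [hσ₂.reg 7 (by decide), h₁.1, Data.record_stack]

/-- One pass of the loop simulates one abstract step; register 12 mirrors `running`, so the loop
stops exactly at the final state. -/
theorem halts_search {B : ℕ} {D : Data} (hD : D.Bounded) (hB : D.n + D.k + 1 ≤ B) {N : ℕ}
    {s s' : State} (hr : D.Reach N s s') (hs' : s'.running = false) :
    ∀ {σ : Store}, Holds D s σ →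
      Halts B (.loop (.var 12) stepProg) (N * ((D.n + 1) * (D.n + 1) * 240 + 2) + 2) σ
        (Holds D s') := by
  induction hr with
  | refl s =>
    intro σ h
    refine ⟨_, σ, .loop_done ?_, ?_, h⟩
    · simp [Expr.eval, h.running, hs']
    · simp [Expr.cost]
  | @step N s s' hs _ ih =>
    intro σ h
    obtain ⟨t₁, σ₁, hr₁, ht₁, h₁⟩ := halts_stepProg hD h hB
    obtain ⟨t₂, σ₂, hr₂, ht₂, h₂⟩ := ih hs' h₁
    refine ⟨_, σ₂, .loop_step ?_ hr₁ hr₂, ?_, h₂⟩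
    · simp [Expr.eval, h.running, hs]
    · have hc : (Expr.var 12).cost = 1 := rfl
      rw [hc, Nat.add_mul N 1, one_mul]
      omega

/-! ### Preprocessing: cardinalities and the facet table. -/

/-- `1` if two numbers are equal, and `0` otherwise. -/
def eqExpr (a b : Expr) : Expr := .minus (.lit 1) (.plus (.minus a b) (.minus b a))

theorem eval_eqExpr (a b : Expr) (σ : Store) :
    (eqExpr a b).eval σ = if a.eval σ = b.eval σ then 1 else 0 := by
  simp only [eqExpr, Expr.eval]
  split_ifs <;> omega

/-- The entry of the input matrix for the simplex `i` and the vertex `j`. -/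
def vertexEntry (i j : Expr) : Expr := .read 0 (.plus (.times i (.var 1)) j)

/-- Compute the cardinalities of all simplices and mark the `r`-simplices. -/
def cardProg : Cmd :=
  .forUp 4 0 (.seq (.assign 6 (.lit 0)) (.seq
    (.forUp 5 1 (.assign 6 (.plus (.var 6) (vertexEntry (.var 4) (.var 5)))))
    (.seq (.write 3 (.var 4) (.var 6))
      (.write 7 (.var 4) (eqExpr (.var 6) (.plus (.var 2) (.lit 1)))))))

/-- Store in register 6 whether each vertex of the simplex in register 10 belongs to the simplex
in register 4. -/
def subsetProg : Cmd :=
  .seq (.assign 6 (.lit 1)) (.forUp 5 1 (.assign 6 (.times (.var 6) (.minus (.lit 1) (.times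
    (vertexEntry (.var 10) (.var 5)) (.minus (.lit 1) (vertexEntry (.var 4) (.var 5))))))))

/-- Compute the facet relation. -/
def facetProg : Cmd :=
  .forUp 4 0 (.forUp 10 0 (.seq subsetProg
    (.write 4 (.plus (.times (.var 4) (.var 0)) (.var 10)) (.times (.var 6)
      (.times (.read 7 (.var 10)) (eqExpr (.read 3 (.var 4)) (.plus (.var 2) (.lit 2))))))))

theorem halts_cardProg {B n m r : ℕ} {σ : Store} (g : ℕ → ℕ → ℕ) (h0 : σ.reg 0 = n)
    (h1 : σ.reg 1 = m) (h2 : σ.reg 2 = r) (hmn : m ≤ n) (hB : n + 1 ≤ B)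
    (hg : ∀ i < n, ∀ j < m, σ.arr 0 (i * m + j) = g i j) (hg1 : ∀ i j, g i j ≤ 1) :
    Halts B cardProg ((n + 1) * (n + 1) * 60) σ (fun σ' => ∀ i < n,
      σ'.arr 3 i = ∑ j ∈ Finset.range m, g i j ∧
      σ'.arr 7 i = if ∑ j ∈ Finset.range m, g i j = r + 1 then 1 else 0) := by
  -- Partial sums of bits stay below the word bound.
  have hsum : ∀ i l, l ≤ m → ∑ j ∈ Finset.range l, g i j ≤ m := fun i l hl =>
    (Finset.sum_le_card_nsmul _ _ 1 fun j _ => hg1 i j).trans (by simpa using hl)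
  refine Halts.mono (Halts.forUp (T := m * 17 + 30) (n := n) (fun l σ' => ∀ i < l,
      σ'.arr 3 i = ∑ j ∈ Finset.range m, g i j ∧
      σ'.arr 7 i = if ∑ j ∈ Finset.range m, g i j = r + 1 then 1 else 0) h0 (by omega) (by decide)
      (by decide) (by simp) ?_) (by nlinarith) fun _ _ h => h
  intro i hi σ₁ hσ₁ h4 hinv
  have b1 : σ₁.reg 1 = m := (hσ₁.reg 1 (by decide)).trans h1
  have b2 : σ₁.reg 2 = r := (hσ₁.reg 2 (by decide)).trans h2
  have a0 : σ₁.arr 0 = σ.arr 0 := hσ₁.arr 0 (by decide)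
  refine Halts.mono (Halts.assign_seq (Nat.zero_le _) (Halts.seq
    (Halts.forUp (T := 9) (n := m) (fun l σ' => σ'.reg 6 = ∑ j ∈ Finset.range l, g i j)
      (by simpa using b1) (by omega) (by decide) (by decide) (by simp [Expr.eval]) ?_)
    fun σ₂ hσ₂ h₂ => Halts.write_seq ?_ ?_ (Halts.write ?_ ?_ (Q := fun σ' => ∀ l < i + 1,
      σ'.arr 3 l = ∑ j ∈ Finset.range m, g l j ∧
      σ'.arr 7 l = if ∑ j ∈ Finset.range m, g l j = r + 1 then 1 else 0) ?_))) ?_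
    fun _ _ h => by simpa using h
  · intro j hj σ₂ hσ₂ h5 hinv₂
    have c1 : σ₂.reg 1 = m := (hσ₂.reg 1 (by decide)).trans (by simpa using b1)
    have c4 : σ₂.reg 4 = i := (hσ₂.reg 4 (by decide)).trans (by simpa using h4)
    have c0 : σ₂.arr 0 = σ.arr 0 := (hσ₂.arr 0 (by decide)).trans (by simpa using a0)
    have hev : (Expr.plus (.var 6) (vertexEntry (.var 4) (.var 5))).eval σ₂ =
        ∑ j ∈ Finset.range (j + 1), g i j := by
      simp only [vertexEntry, Expr.eval, c0, c1, c4, h5, hinv₂, hg i hi j hj,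
        Finset.sum_range_succ]
    refine Halts.assign ?_ ?_
    · rw [hev]
      have := hsum i (j + 1) hj
      omega
    · simpa using hev
  · simp only [Expr.eval, hσ₂.reg 4 (by decide)]
    simp [h4]
    omega
  · simp only [Expr.eval, h₂]
    have := hsum i m le_rfl
    omega
  · simp only [Expr.eval, Store.reg_setArr, hσ₂.reg 4 (by decide)]
    simp [h4]
    omega
  · rw [eval_eqExpr]
    split_ifs <;> omega
  · have d4 : σ₂.reg 4 = i := (hσ₂.reg 4 (by decide)).trans (by simpa using h4)
    have d2 : σ₂.reg 2 = r := (hσ₂.reg 2 (by decide)).trans (by simpa using b2)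
    have d3 : σ₂.arr 3 = σ₁.arr 3 := hσ₂.arr 3 (by decide)
    have d7 : σ₂.arr 7 = σ₁.arr 7 := hσ₂.arr 7 (by decide)
    intro l hl
    simp only [eval_eqExpr, Expr.eval, Store.reg_setArr, Store.arr_setArr, d4, h₂, d2, d3, d7]
    rcases (Nat.lt_succ_iff_lt_or_eq.1 hl) with hl | rfl
    · simpa [hl.ne] using hinv l hl
    · simp
  · simp only [eqExpr, Expr.cost]
    omega

theorem halts_subsetProg {B n m u x : ℕ} {σ : Store} (g : ℕ → ℕ → ℕ) (h1 : σ.reg 1 = m)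
    (h4 : σ.reg 4 = u) (h10 : σ.reg 10 = x) (hB : m + 1 ≤ B) (hu : u < n) (hx : x < n)
    (hg : ∀ i < n, ∀ j < m, σ.arr 0 (i * m + j) = g i j) :
    Halts B subsetProg (m * 28 + 8) σ (fun σ' =>
      σ'.reg 6 = if ∀ j < m, g x j * (1 - g u j) = 0 then 1 else 0) := by
  refine Halts.mono (Halts.assign_seq (by simp only [Expr.eval]; omega)
    (Halts.forUp (T := 20) (n := m)
      (fun l σ' => σ'.reg 6 = if ∀ j < l, g x j * (1 - g u j) = 0 then 1 else 0)
      (by simpa using h1) (by omega) (by decide) (by decide) (by simp [Expr.eval]) ?_))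
    (by simp only [Expr.cost]; omega) fun _ _ h => h
  intro j hj σ₃ hσ₃ h5 hinv
  have k1 : σ₃.reg 1 = m := (hσ₃.reg 1 (by decide)).trans (by simpa using h1)
  have k4 : σ₃.reg 4 = u := (hσ₃.reg 4 (by decide)).trans (by simpa using h4)
  have k10 : σ₃.reg 10 = x := (hσ₃.reg 10 (by decide)).trans (by simpa using h10)
  have k0 : σ₃.arr 0 = σ.arr 0 := hσ₃.arr 0 (by decide)
  have hev : (Expr.times (.var 6) (.minus (.lit 1) (.times
      (vertexEntry (.var 10) (.var 5)) (.minus (.lit 1)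
        (vertexEntry (.var 4) (.var 5)))))).eval σ₃ =
      if ∀ l < j + 1, g x l * (1 - g u l) = 0 then 1 else 0 := by
    simp only [vertexEntry, Expr.eval, k0, k1, k4, k10, h5, hinv, hg u hu j hj,
      hg x hx j hj, Nat.forall_lt_succ_right]
    by_cases hA : ∀ l < j, g x l * (1 - g u l) = 0
    · by_cases hB : g x j * (1 - g u j) = 0
      · rw [if_pos hA, if_pos ⟨hA, hB⟩, hB]
      · rw [if_pos hA, if_neg fun h => hB h.2]
        omega
    · rw [if_neg hA, if_neg fun h => hA h.1, zero_mul]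
  refine Halts.assign ?_ ?_
  · rw [hev]
    split_ifs <;> omega
  · simpa using hev

theorem mul_indicators (P Q R : Prop) [Decidable P] [Decidable Q] [Decidable R] :
    (if P then 1 else 0) * ((if Q then 1 else 0) * (if R then 1 else 0)) =
      if Q ∧ R ∧ P then 1 else 0 := by
  by_cases P <;> by_cases Q <;> by_cases R <;> simp [*]

/-- The value of the facet relation at two simplices with vertices `g` and cardinalities `c`. -/
def facetValue (m r : ℕ) (g : ℕ → ℕ → ℕ) (c : ℕ → ℕ) (u x : ℕ) : ℕ :=
  if c x = r + 1 ∧ c u = r + 2 ∧ ∀ j < m, g x j * (1 - g u j) = 0 then 1 else 0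

theorem facetValue_le_one (m r : ℕ) (g : ℕ → ℕ → ℕ) (c : ℕ → ℕ) (u x : ℕ) :
    facetValue m r g c u x ≤ 1 := by
  unfold facetValue
  split_ifs <;> omega

/-- The table is stored row by row, so both loops share one invariant about all positions below the
current one, with `p / n` and `p % n` as coordinates. Positions are write addresses, hence the
quadratic word bound. -/
theorem halts_facetProg {B n m r : ℕ} {σ : Store} (g : ℕ → ℕ → ℕ) (c : ℕ → ℕ)
    (h0 : σ.reg 0 = n) (h1 : σ.reg 1 = m) (h2 : σ.reg 2 = r) (hmn : m ≤ n)
    (hB : n * n + n + 1 ≤ B) (hg : ∀ i < n, ∀ j < m, σ.arr 0 (i * m + j) = g i j)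
    (h3 : ∀ i < n, σ.arr 3 i = c i) (h7 : ∀ i < n, σ.arr 7 i = if c i = r + 1 then 1 else 0) :
    Halts B facetProg ((n + 1) * (n + 1) * (n + 1) * 100) σ (fun σ' =>
      ∀ u < n, ∀ x < n, σ'.arr 4 (u * n + x) = facetValue m r g c u x) := by
  refine Halts.mono (Halts.forUp (T := n * (m * 28 + 50) + 6) (n := n)
    (fun u σ' => ∀ p < u * n, σ'.arr 4 p = facetValue m r g c (p / n) (p % n)) h0 (by nlinarith)
      (by decide) (by decide) (by simp) ?_) ?_ fun σ' _ h u hu x hx => ?_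
  · intro u hu σ₁ hσ₁ h4 hinv
    have b0 : σ₁.reg 0 = n := (hσ₁.reg 0 (by decide)).trans h0
    have b1 : σ₁.reg 1 = m := (hσ₁.reg 1 (by decide)).trans h1
    have b2 : σ₁.reg 2 = r := (hσ₁.reg 2 (by decide)).trans h2
    have e0 : σ₁.arr 0 = σ.arr 0 := hσ₁.arr 0 (by decide)
    have e3 : σ₁.arr 3 = σ.arr 3 := hσ₁.arr 3 (by decide)
    have e7 : σ₁.arr 7 = σ.arr 7 := hσ₁.arr 7 (by decide)
    refine Halts.mono (Halts.forUp (T := m * 28 + 42) (n := n)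
      (fun x σ' => ∀ p < u * n + x, σ'.arr 4 p = facetValue m r g c (p / n) (p % n)) b0
        (by nlinarith) (by decide) (by decide) (by simpa using hinv) ?_) (by nlinarith)
        fun σ' _ h => ?_
    · intro x hx σ₂ hσ₂ h10 hinv₂
      have c0 : σ₂.reg 0 = n := (hσ₂.reg 0 (by decide)).trans b0
      have c1 : σ₂.reg 1 = m := (hσ₂.reg 1 (by decide)).trans b1
      have c2 : σ₂.reg 2 = r := (hσ₂.reg 2 (by decide)).trans b2
      have c4 : σ₂.reg 4 = u := (hσ₂.reg 4 (by decide)).trans h4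
      have f0 : σ₂.arr 0 = σ.arr 0 := (hσ₂.arr 0 (by decide)).trans e0
      have f3 : σ₂.arr 3 = σ.arr 3 := (hσ₂.arr 3 (by decide)).trans e3
      have f7 : σ₂.arr 7 = σ.arr 7 := (hσ₂.arr 7 (by decide)).trans e7
      have hxu : u * n + x < n * n := by nlinarith
      refine Halts.mono (Halts.seq (halts_subsetProg g c1 c4 h10 (by omega) hu hx
        (by rw [f0]; exact hg)) fun σ₃ hσ₃ h₃ => ?_) (T := m * 28 + 8 + 30)
        (Q := fun σ' => ∀ p < u * n + (x + 1),
          σ'.arr 4 p = facetValue m r g c (p / n) (p % n)) (by omega) fun _ _ h => by simpa using h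
      have k0 : σ₃.reg 0 = n := (hσ₃.reg 0 (by decide)).trans c0
      have k2 : σ₃.reg 2 = r := (hσ₃.reg 2 (by decide)).trans c2
      have k4 : σ₃.reg 4 = u := (hσ₃.reg 4 (by decide)).trans c4
      have k10 : σ₃.reg 10 = x := (hσ₃.reg 10 (by decide)).trans h10
      have l3 : σ₃.arr 3 = σ.arr 3 := (hσ₃.arr 3 (by decide)).trans f3
      have l7 : σ₃.arr 7 = σ.arr 7 := (hσ₃.arr 7 (by decide)).trans f7
      have l4 : σ₃.arr 4 = σ₂.arr 4 := hσ₃.arr 4 (by decide)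
      have hev : (Expr.times (.var 6) (.times (.read 7 (.var 10))
          (eqExpr (.read 3 (.var 4)) (.plus (.var 2) (.lit 2))))).eval σ₃ =
          facetValue m r g c u x := by
        simp only [Expr.eval, eval_eqExpr, h₃, l7, l3, k4, k10, k2, h3 u hu, h7 x hx,
          mul_indicators, facetValue]
      have hix : (Expr.plus (.times (.var 4) (.var 0)) (.var 10)).eval σ₃ = u * n + x := by
        simp only [Expr.eval, k4, k0, k10]
      refine Halts.mono (Halts.write ?_ ?_ ?_) (Q := fun σ' => ∀ p < u * n + (x + 1),
          σ'.arr 4 p = facetValue m r g c (p / n) (p % n)) ?_ fun _ _ h => h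
      · rw [hix]
        omega
      · rw [hev]
        exact (facetValue_le_one _ _ _ _ _ _).trans (by omega)
      · intro p hp
        rw [Store.arr_setArr, hix, hev]
        by_cases hpx : p = u * n + x
        · have hdiv : p / n = u := by
            rw [hpx, mul_comm, Nat.mul_add_div (by omega), Nat.div_eq_of_lt hx, add_zero]
          have hmod : p % n = x := by
            rw [hpx, mul_comm, Nat.mul_add_mod, Nat.mod_eq_of_lt hx]
          rw [if_pos ⟨rfl, hpx⟩, hdiv, hmod]
        · rw [if_neg fun h => hpx h.2, l4]
          exact hinv₂ p (by omega)
      · simp only [eqExpr, Expr.cost]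
        omega
    · intro p hp
      rw [Store.arr_setReg]
      exact h p (by rwa [add_mul, one_mul] at hp)
  · have h₁ : n * (m * 28 + 50) ≤ n * (n * 28 + 50) := by gcongr
    have h₂ : n * (n * (m * 28 + 50) + 6 + 8) ≤ n * (n * (n * 28 + 50) + 6 + 8) := by gcongr
    nlinarith [Nat.zero_le (n * n * n), Nat.zero_le (n * n)]
  · have hlt : u * n + x < n * n := by nlinarith
    rw [h _ hlt, mul_comm u n, Nat.mul_add_div (by omega), Nat.div_eq_of_lt hx, add_zero,
      Nat.mul_add_mod, Nat.mod_eq_of_lt hx]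

end CocycleSearch

/-! ### The complete program. -/

namespace CocycleSearch

open RAM

/-- The program that solves Topological Hitting Set. -/
def mainProg : Cmd :=
  .seq cardProg (.seq facetProg (.seq (.assign 10 (.lit 0))
    (.seq (.assign 11 (.plus (.var 3) (.lit 1))) (.seq (.assign 12 (.lit 1))
      (.seq (.loop (.var 12) stepProg)
        -- As the best size is at most `k + 1`, this is 1 if a solution was found and 0 otherwise.
        (.assign 0 (.minus (.lit 1) (.minus (.var 11) (.var 3)))))))))

theorem halts_mainProg {B m r Δ : ℕ} {σ : Store} {D : Data} (hD : D.Bounded)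
    (hΔ : ∀ u, (D.F u).card ≤ Δ) (g : ℕ → ℕ → ℕ) (hg1 : ∀ i j, g i j ≤ 1)
    (h0 : σ.reg 0 = D.n) (h1 : σ.reg 1 = m) (h2 : σ.reg 2 = r) (h3 : σ.reg 3 = D.k)
    (h9 : σ.reg 9 = 0) (hmn : m ≤ D.n) (hB : (D.n + D.k + 2) ^ 2 ≤ B)
    (ha0 : ∀ i < D.n, ∀ j < m, σ.arr 0 (i * m + j) = g i j)
    (ha1 : ∀ y < D.n, σ.arr 1 y = if y ∈ D.Z then 1 else 0)
    (ha2 : ∀ y, σ.arr 2 y = 0) (ha6 : ∀ y, σ.arr 6 y = 0)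
    (hF : ∀ u < D.n, ∀ x < D.n,
      facetValue m r g (fun i => ∑ j ∈ Finset.range m, g i j) u x = if x ∈ D.F u then 1 else 0)
    (hR : ∀ x < D.n, ∑ j ∈ Finset.range m, g x j = r + 1 ↔ x ∈ D.R) :
    Halts B mainProg (1000 * (D.n + 1) ^ 4 * (Δ + 1) ^ D.k) σ (fun σ' => ∃ best out,
      D.Sound best out ∧ (∀ T, D.IsMinimum T → best ≤ T.card) ∧
      σ'.reg 0 = (if best ≤ D.k then 1 else 0) ∧
      ∀ y < D.n, σ'.arr 2 y = if y ∈ out then 1 else 0) := by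
  obtain ⟨N, best, out, hreach, hN, hsound, hmin⟩ :=
    Data.exists_reach_final hΔ fun y hy => Finset.mem_range.1 (hD.R hy)
  have hB1 : D.n * D.n + D.n + 1 ≤ B ∧ D.n + D.k + 2 ≤ B := by
    constructor <;> nlinarith [Nat.zero_le (D.n * D.k)]
  refine Halts.mono (Halts.seq (halts_cardProg g h0 h1 h2 hmn (by omega) ha0 hg1)
    fun σ₁ hσ₁ h₁ => Halts.seq (halts_facetProg g (fun i => ∑ j ∈ Finset.range m, g i j)
      (n := D.n) (m := m) (r := r) ((hσ₁.reg 0 (by decide)).trans h0)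
      ((hσ₁.reg 1 (by decide)).trans h1) ((hσ₁.reg 2 (by decide)).trans h2) hmn (by omega)
      (by rw [hσ₁.arr 0 (by decide)]; exact ha0) (fun i hi => (h₁ i hi).1)
      fun i hi => (h₁ i hi).2)
    fun σ₂ hσ₂ h₂ => Halts.assign_seq (Nat.zero_le _) (Halts.assign_seq ?_ (Halts.assign_seq ?_
      (Halts.seq (halts_search hD (by omega) hreach rfl ?_) fun σ₃ hσ₃ h₃ =>
        Halts.assign (Q := fun σ' => σ'.reg 0 = (if best ≤ D.k then 1 else 0) ∧
          ∀ y < D.n, σ'.arr 2 y = if y ∈ out then 1 else 0) ?_ ?_)))) ?_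
    fun σ' _ h => ⟨best, out, hsound, hmin, h⟩
  · have e3 : σ₂.reg 3 = D.k :=
      (hσ₂.reg 3 (by decide)).trans ((hσ₁.reg 3 (by decide)).trans h3)
    simp [Expr.eval, e3]
    omega
  · simp only [Expr.eval]
    omega
  · have r : ∀ x, x ∉ [4, 5, 6, 10] → σ₂.reg x = σ.reg x := fun x hx => by
      simp only [List.mem_cons, List.not_mem_nil, or_false, not_or] at hx
      exact (hσ₂.reg x (by simp [facetProg, subsetProg, Cmd.forUp, Cmd.regs, hx])).trans
        (hσ₁.reg x (by simp [cardProg, Cmd.forUp, Cmd.regs, hx]))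
    have a : ∀ x, x ∉ [3, 4, 7] → σ₂.arr x = σ.arr x := fun x hx => by
      simp only [List.mem_cons, List.not_mem_nil, or_false, not_or] at hx
      exact (hσ₂.arr x (by simp [facetProg, subsetProg, Cmd.forUp, Cmd.arrs, hx])).trans
        (hσ₁.arr x (by simp [cardProg, Cmd.forUp, Cmd.arrs, hx]))
    have a7 : σ₂.arr 7 = σ₁.arr 7 := hσ₂.arr 7 (by decide)
    exact {
      n := by simpa using (r 0 (by decide)).trans h0
      k := by simpa using (r 3 (by decide)).trans h3
      F := fun u hu x hx => (h₂ u hu x hx).trans (hF u hu x hx)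
      R := fun y hy => by
        simp only [Store.arr_setReg, a7, (h₁ y hy).2, hR y hy]
      Z := by simpa [a 1 (by decide)] using ha1
      len := by simpa using (r 9 (by decide)).trans h9
      x := by simp [Expr.eval]
      best := by simpa [Expr.eval] using (r 3 (by decide)).trans h3
      running := by simp [Expr.eval]
      stack := trivial
      mem := by simpa [a 6 (by decide)] using ha6
      out := by simpa [a 2 (by decide)] using fun y _ => ha2 y
      nodup := List.nodup_nil
      len_le := Nat.zero_le _
      lt := by simp
      x_le := Nat.zero_le _ }
  · simp only [Expr.eval]
    omega
  · refine ⟨?_, h₃.out⟩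
    have e11 := h₃.best
    simp only at e11
    simp only [Expr.eval, Store.reg_setReg, if_true, e11, h₃.k]
    split_ifs <;> omega
  · simp only [Expr.cost]
    have hP : 1 ≤ (Δ + 1) ^ D.k := Nat.one_le_pow _ _ (Nat.succ_pos _)
    have ha : 1 ≤ D.n + 1 := Nat.le_add_left 1 D.n
    generalize (Δ + 1) ^ D.k = P at hN hP ⊢
    generalize D.n + 1 = a at hN ha ⊢
    -- The search dominates with `a^2 P` steps of cost at most `242 a^2`; every preprocessing term
    -- is absorbed into `a^4 P` as well.
    have hp : ∀ i ≤ 4, a ^ i ≤ a ^ 4 * P := fun i hi =>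
      (Nat.pow_le_pow_right ha hi).trans (Nat.le_mul_of_pos_right _ hP)
    have h₂ := hp 2 (by decide)
    have h₃ := hp 3 (by decide)
    have h₀ := hp 0 (by decide)
    have h₄ : N * (a * a * 240 + 2) ≤ a ^ 4 * P * 242 := by
      have : a * a * 240 + 2 ≤ a ^ 2 * 242 := by nlinarith
      calc _ ≤ a ^ 2 * P * (a ^ 2 * 242) := Nat.mul_le_mul hN this
        _ = _ := by ring
    have e₂ : a * a = a ^ 2 := by ring
    have e₃ : a * a * a = a ^ 3 := by ring
    have e₄ : 1000 * a ^ 4 * P = 1000 * (a ^ 4 * P) := by ring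
    rw [e₃, e₄]
    rw [e₂] at h₄ ⊢
    rw [pow_zero] at h₀
    omega

theorem Data.exists_isMinimum (D : Data) {T : Finset ℕ} (hT : T ⊆ D.R) (hodd : D.IsOdd T)
    (hk : T.card ≤ D.k) : ∃ T', D.IsMinimum T' ∧ T'.card ≤ T.card := by
  obtain ⟨T', hT', hmin⟩ := Finset.exists_min_image (D.R.powerset.filter fun T => D.IsOdd T)
    Finset.card ⟨T, Finset.mem_filter.2 ⟨Finset.mem_powerset.2 hT, hodd⟩⟩
  obtain ⟨h₁, h₂⟩ := Finset.mem_filter.1 hT'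
  have hle := hmin T (Finset.mem_filter.2 ⟨Finset.mem_powerset.2 hT, hodd⟩)
  exact ⟨T', ⟨Finset.mem_powerset.1 h₁, h₂, hle.trans hk, fun T'' h h' =>
    hmin T'' (Finset.mem_filter.2 ⟨Finset.mem_powerset.2 h, h'⟩)⟩, hle⟩

end CocycleSearch

/-! ### Translation between simplices and their positions in the input. -/

namespace THSInstance

open CocycleSearch AbstractSimplicialComplex

variable (I : THSInstance) (e : Fin I.K.size ≃ I.K.Simplex)

/-- The vertices of the `i`-th simplex. -/
noncomputable def verts (i : ℕ) : Finset (Fin I.m) :=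
  -- Outside the list the value is empty, and an empty set is never mistaken for a simplex.
  if h : i < I.K.size then (e ⟨i, h⟩).1 else ∅

/-- The position of an `r`-simplex in the list of all simplices. -/
noncomputable def index {p : ℕ} (s : I.K.Face p) : ℕ := e.symm s.toSimplex

variable {I}

theorem index_lt {p : ℕ} (s : I.K.Face p) : I.index e s < I.K.size := (e.symm _).2

theorem verts_index {p : ℕ} (s : I.K.Face p) : I.verts e (I.index e s) = s.1 := by
  rw [verts, dif_pos (index_lt e s)]
  simp [index, Face.toSimplex]

theorem index_injective {p : ℕ} : Function.Injective (I.index e : I.K.Face p → ℕ) :=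
  fun s t h => Subtype.ext (by rw [← verts_index e s, h, verts_index])

theorem exists_index_eq {p i : ℕ} (h : (I.verts e i).card = p + 1) :
    ∃ s : I.K.Face p, I.index e s = i := by
  by_cases hi : i < I.K.size
  · rw [verts, dif_pos hi] at h
    refine ⟨⟨(e ⟨i, hi⟩).1, (e ⟨i, hi⟩).2, h⟩, ?_⟩
    simp [index, Face.toSimplex]
  · rw [verts, dif_neg hi] at h
    simp at h

variable (I)

open Classical in
/-- The data of the search for the instance `I` with its simplices listed in the order `e`. -/
noncomputable def searchData : Data where
  n := I.K.size
  k := I.k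
  F u := (Finset.range I.K.size).filter fun x =>
    (I.verts e x).card = I.r + 1 ∧ (I.verts e u).card = I.r + 2 ∧ I.verts e x ⊆ I.verts e u
  R := (Finset.range I.K.size).filter fun x => (I.verts e x).card = I.r + 1
  Z := (Finset.range I.K.size).filter fun x => ∃ s : I.K.Face I.r, I.index e s = x ∧ I.ζ s ≠ 0

theorem searchData_bounded : (I.searchData e).Bounded :=
  ⟨fun _ => Finset.filter_subset _ _, Finset.filter_subset _ _, Finset.filter_subset _ _⟩

variable {I}

theorem mem_R_iff {x : ℕ} :
    x ∈ (I.searchData e).R ↔ ∃ s : I.K.Face I.r, I.index e s = x := by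
  simp only [searchData, Finset.mem_filter, Finset.mem_range]
  constructor
  · rintro ⟨-, h⟩
    exact exists_index_eq e h
  · rintro ⟨s, rfl⟩
    exact ⟨index_lt e s, by rw [verts_index, s.2.2]⟩

theorem index_mem_Z_iff {s : I.K.Face I.r} :
    I.index e s ∈ (I.searchData e).Z ↔ I.ζ s ≠ 0 := by
  simp only [searchData, Finset.mem_filter, Finset.mem_range]
  constructor
  · rintro ⟨-, t, h, ht⟩
    rwa [← index_injective e h]
  · intro h
    exact ⟨index_lt e s, s, rfl, h⟩

theorem index_mem_F_iff {s : I.K.Face I.r} {u : I.K.Face (I.r + 1)} :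
    I.index e s ∈ (I.searchData e).F (I.index e u) ↔ s.1 ⊆ u.1 := by
  simp only [searchData, Finset.mem_filter, Finset.mem_range, verts_index, s.2.2, u.2.2, true_and,
    index_lt e s]

theorem F_eq_empty_or (u : ℕ) : (I.searchData e).F u = ∅ ∨
    ∃ t : I.K.Face (I.r + 1), I.index e t = u := by
  by_cases h : (I.verts e u).card = I.r + 2
  · exact Or.inr (exists_index_eq e h)
  · left
    simp [searchData, h]

open Classical in
theorem inter_image_index (A : Finset ℕ) (S : Finset (I.K.Face I.r)) :
    (A ∩ S.image (I.index e)).card = (S.filter fun s => I.index e s ∈ A).card := by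
  rw [← Finset.card_image_of_injective (S.filter fun s => I.index e s ∈ A) (index_injective e)]
  congr 1
  ext x
  simp only [Finset.mem_inter, Finset.mem_image, Finset.mem_filter]
  constructor
  · rintro ⟨h, s, hs, rfl⟩
    exact ⟨s, ⟨hs, h⟩, rfl⟩
  · rintro ⟨s, ⟨hs, h⟩, rfl⟩
    exact ⟨h, s, hs, rfl⟩

-- Parities of cardinalities are sums in `ZMod 2`. Positions that are not `(r + 1)`-simplices have
-- no facets in the data and impose no condition.
open Classical in
theorem isOdd_image_iff (S : Finset (I.K.Face I.r)) :
    (I.searchData e).IsOdd (S.image (I.index e)) ↔ I.K.IsOddCocycle I.ζ S := by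
  have two : ∀ x : ZMod 2, x = if x ≠ 0 then 1 else 0 := by decide
  refine and_congr ?_ ?_
  · rw [Data.pivot_eq_zero]
    have key : ∀ u : I.K.Face (I.r + 1),
        ((I.searchData e).F (I.index e u) ∩ S.image (I.index e)).card % 2 = 0 ↔
          ∑ s ∈ S, I.K.boundaryMatrix I.r s u = 0 := by
      intro u
      rw [inter_image_index, ← Nat.dvd_iff_mod_eq_zero, ← ZMod.natCast_eq_zero_iff,
        Finset.natCast_card_filter]
      simp only [index_mem_F_iff, boundaryMatrix, Matrix.of_apply]
      convert Iff.rfl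
    constructor
    · intro h u
      exact (key u).1 (h _ (index_lt e u))
    · intro h u _
      rcases F_eq_empty_or e u with hu | ⟨t, rfl⟩
      · simp [hu]
      · exact (key t).2 (h t)
  · rw [inter_image_index, Finset.sum_congr rfl fun s _ => two (I.ζ s),
      ← Finset.natCast_card_filter]
    simp only [index_mem_Z_iff]
    rw [ZMod.natCast_eq_one_iff_odd, Nat.odd_iff]

open Classical in
theorem exists_image_index {T : Finset ℕ} (hT : T ⊆ (I.searchData e).R) :
    ∃ S : Finset (I.K.Face I.r), S.image (I.index e) = T := by
  refine ⟨Finset.univ.filter fun s => I.index e s ∈ T, ?_⟩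
  ext x
  simp only [Finset.mem_image, Finset.mem_filter, Finset.mem_univ, true_and]
  constructor
  · rintro ⟨s, hs, rfl⟩
    exact hs
  · intro hx
    obtain ⟨s, rfl⟩ := (mem_R_iff e).1 (hT hx)
    exact ⟨s, hx, rfl⟩

open Classical in
theorem card_F_le (u : ℕ) : ((I.searchData e).F u).card ≤ I.K.maxHasseDegree := by
  rcases F_eq_empty_or e u with hu | ⟨t, rfl⟩
  · simp [hu]
  · refine le_trans ?_ (I.K.hasseGraph.degree_le_maxDegree t.toSimplex)
    rw [← SimpleGraph.card_neighborFinset_eq_degree]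
    have hsub : (I.searchData e).F (I.index e t) ⊆
        (I.K.hasseGraph.neighborFinset t.toSimplex).image fun s => (e.symm s : ℕ) := by
      intro x hx
      obtain ⟨s, rfl⟩ := (mem_R_iff e).1 (Finset.mem_filter.2
        ⟨(Finset.mem_filter.1 hx).1, (Finset.mem_filter.1 hx).2.1⟩)
      refine Finset.mem_image.2 ⟨s.toSimplex, ?_, rfl⟩
      rw [SimpleGraph.mem_neighborFinset]
      exact Or.inr (Face.isFacet_toSimplex ((index_mem_F_iff e).1 hx))
    exact (Finset.card_le_card hsub).trans Finset.card_image_le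

variable (I) in
open Classical in
/-- The entry of the input matrix. -/
noncomputable def vertexBit (i j : ℕ) : ℕ :=
  if ∃ h : j < I.m, ⟨j, h⟩ ∈ I.verts e i then 1 else 0

open Classical in
theorem sum_vertexBit (i : ℕ) :
    ∑ j ∈ Finset.range I.m, I.vertexBit e i j = (I.verts e i).card := by
  rw [← Fin.sum_univ_eq_sum_range]
  simp [vertexBit]

theorem input_arr_zero {i j : ℕ} (hi : i < I.K.size) (hj : j < I.m) :
    (I.input e).arr 0 (i * I.m + j) = I.vertexBit e i j := by
  simp only [input, vertexBit]
  refine if_congr ?_ rfl rfl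
  constructor
  · rintro ⟨i', j', h, hmem⟩
    have hm : 0 < I.m := by omega
    -- Only flattened positions are known to agree; division by `m` recovers the row.
    have h₁ : (i * I.m + j) / I.m = i := by
      rw [mul_comm, Nat.mul_add_div hm, Nat.div_eq_of_lt hj, add_zero]
    have h₂ : (i' * I.m + j') / I.m = i' := by
      rw [mul_comm, Nat.mul_add_div hm, Nat.div_eq_of_lt j'.2, add_zero]
    have h₃ : i = i' := by rw [← h₁, h, h₂]
    subst h₃
    have h₄ : j = j' := by omega
    subst h₄
    exact ⟨j'.2, by rw [verts, dif_pos i'.2]; exact hmem⟩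
  · rintro ⟨h, hmem⟩
    rw [verts, dif_pos hi] at hmem
    exact ⟨⟨i, hi⟩, ⟨j, h⟩, rfl, hmem⟩

theorem input_arr_one {i : ℕ} (hi : i < I.K.size) :
    (I.input e).arr 1 i = if i ∈ (I.searchData e).Z then 1 else 0 := by
  simp only [input]
  refine if_congr ?_ rfl rfl
  simp only [searchData, Finset.mem_filter, Finset.mem_range, hi, true_and]
  constructor
  · rintro ⟨i', s, rfl, hs, hζ⟩
    exact ⟨s, by rw [index, ← hs, Equiv.symm_apply_apply], hζ⟩
  · rintro ⟨s, rfl, hζ⟩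
    exact ⟨e.symm s.toSimplex, s, rfl, e.apply_symm_apply _, hζ⟩

theorem facetValue_vertexBit {u x : ℕ} (hx : x < I.K.size) :
    facetValue I.m I.r (I.vertexBit e)
      (fun i => ∑ j ∈ Finset.range I.m, I.vertexBit e i j) u x =
        if x ∈ (I.searchData e).F u then 1 else 0 := by
  simp only [facetValue, sum_vertexBit]
  refine if_congr ?_ rfl rfl
  simp only [searchData, Finset.mem_filter, Finset.mem_range, hx, true_and]
  refine and_congr Iff.rfl (and_congr Iff.rfl ⟨fun h v hv => ?_, fun h j hj => ?_⟩)
  · have h' := h v v.2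
    by_contra hvu
    simp [vertexBit, hv, hvu] at h'
  · by_cases hj' : (⟨j, hj⟩ : Fin I.m) ∈ I.verts e x
    · simp [vertexBit, hj, hj', h hj']
    · simp [vertexBit, hj, hj']

-- Every vertex is a simplex; this turns costs in `m` into costs in `n`.
variable (I) in
theorem m_le_size : I.m ≤ I.K.size := by
  have h : Function.Injective fun v : Fin I.m => (⟨{v}, I.K.singleton_mem v⟩ : I.K.Simplex) :=
    fun v w h => Finset.singleton_injective (congrArg Subtype.val h)
  simpa [size] using Fintype.card_le_of_injective _ h

-- Some simplex has two vertices, and erasing either one gives two distinct facets. The bound is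
-- needed to compare `Δ + 1` with a power of `k * Δ`.
variable (I) in
open Classical in
theorem two_le_maxHasseDegree : 2 ≤ I.K.maxHasseDegree := by
  have hdim : ∃ t : I.K.Simplex, 1 < t.1.card := by
    by_contra hcon
    push Not at hcon
    have : I.K.dim ≤ 0 := Finset.sup_le fun s _ => by
      have := hcon s
      omega
    have := I.r_lt
    omega
  obtain ⟨t, ht⟩ := hdim
  obtain ⟨a, ha, b, hb, hab⟩ := Finset.one_lt_card.1 ht
  have hface : ∀ v ∈ t.1, t.1.erase v ∈ I.K.faces := fun v hv =>
    (I.K.isRelLowerSet_faces t.2).2 (Finset.erase_subset _ _) (by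
      rw [← Finset.card_pos, Finset.card_erase_of_mem hv]
      omega)
  have hadj : ∀ v (hv : v ∈ t.1), I.K.hasseGraph.Adj t ⟨t.1.erase v, hface v hv⟩ := fun v hv =>
    Or.inr ⟨Finset.erase_subset _ _, by
      change t.1.card = (t.1.erase v).card + 1
      rw [Finset.card_erase_of_mem hv]
      omega⟩
  refine le_trans ?_ (I.K.hasseGraph.degree_le_maxDegree t)
  rw [← SimpleGraph.card_neighborFinset_eq_degree]
  have hne : (⟨t.1.erase a, hface a ha⟩ : I.K.Simplex) ≠ ⟨t.1.erase b, hface b hb⟩ := by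
    intro h
    have h' : t.1.erase a = t.1.erase b := congrArg Subtype.val h
    have : a ∈ t.1.erase a := h' ▸ Finset.mem_erase.2 ⟨hab, ha⟩
    simp at this
  rw [← Finset.card_pair hne]
  refine Finset.card_le_card fun x hx => ?_
  rw [SimpleGraph.mem_neighborFinset]
  rcases Finset.mem_insert.1 hx with rfl | hx
  · exact hadj a ha
  · rw [Finset.mem_singleton.1 hx]
    exact hadj b hb

-- Every hitting set contains an odd cocycle, which is no larger and itself a hitting set; so the
-- smallest odd cocycle is a smallest hitting set.
open Classical in
theorem answers_of_search {best : ℕ} {out : Finset ℕ} {σ : RAM.Store}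
    (hsound : (I.searchData e).Sound best out)
    (hmin : ∀ T, (I.searchData e).IsMinimum T → best ≤ T.card)
    (h0 : σ.reg 0 = if best ≤ I.k then 1 else 0)
    (h2 : ∀ y < I.K.size, σ.arr 2 y = if y ∈ out then 1 else 0) : I.Answers e σ := by
  have hle : ∀ S : Finset (I.K.Face I.r), I.K.IsHittingSet I.ζ S → S.card ≤ I.k →
      best ≤ S.card := by
    intro S hS hk
    obtain ⟨Y, hYS, hY⟩ := hS.exists_isOddCocycle I.isCycle
    have hYS' := Finset.card_le_card hYS
    have hcard := Finset.card_image_of_injective Y (index_injective e)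
    obtain ⟨T, hT, hTY⟩ := (I.searchData e).exists_isMinimum (T := Y.image (I.index e))
      (fun x hx => (mem_R_iff e).2 ((Finset.mem_image.1 hx).imp fun _ h => h.2))
      ((isOdd_image_iff e Y).2 hY) (by rw [hcard]; exact hYS'.trans hk)
    have := hmin T hT
    omega
  by_cases hbest : best ≤ I.k
  · left
    rw [if_pos hbest] at h0
    obtain ⟨hodd, hcard, hR⟩ := hsound.2 hbest
    obtain ⟨S, rfl⟩ := exists_image_index e hR
    rw [Finset.card_image_of_injective S (index_injective e)] at hcard
    refine ⟨h0, S, ((isOdd_image_iff e S).1 hodd).isHittingSet, hcard.trans_le hbest,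
      fun T hT => ?_, fun i => ?_⟩
    · rw [hcard]
      by_cases hTk : T.card ≤ I.k
      · exact hle T hT hTk
      · omega
    · rw [h2 i i.2]
      refine if_congr ?_ rfl rfl
      rw [Finset.mem_image]
      refine exists_congr fun s => and_congr Iff.rfl ?_
      rw [index, Fin.val_inj, Equiv.symm_apply_eq, eq_comm]
  · right
    rw [if_neg hbest] at h0
    exact ⟨h0, fun ⟨S, hS, hk⟩ => hbest ((hle S hS hk).trans hk)⟩

theorem halts_mainProg (B : ℕ) (hB : (I.K.size + I.k + 2) ^ 2 ≤ B) :
    RAM.Halts B mainProg (1000 * (I.K.size + 1) ^ 4 * (I.K.maxHasseDegree + 1) ^ I.k) (I.input e)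
      (I.Answers e) := by
  refine RAM.Halts.mono (CocycleSearch.halts_mainProg (m := I.m) (r := I.r)
    (I.searchData_bounded e) (card_F_le e) (I.vertexBit e) ?_ rfl rfl rfl rfl rfl I.m_le_size hB
    (fun i hi j hj => input_arr_zero e hi hj) (fun y hy => input_arr_one e hy) (fun _ => rfl)
    (fun _ => rfl) (fun u _ x hx => facetValue_vertexBit e hx) ?_) le_rfl ?_
  · intro i j
    unfold vertexBit
    split_ifs <;> omega
  · intro x hx
    rw [sum_vertexBit]
    simp only [searchData, Finset.mem_filter, Finset.mem_range]
    exact ⟨fun h => ⟨hx, h⟩, And.right⟩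
  · rintro σ - ⟨best, out, hsound, hmin, h0, h2⟩
    exact answers_of_search e hsound hmin h0 h2

end THSInstance

/-! ### Estimates for the running time. -/

/-- The exponent of matrix multiplication is not negative. -/
theorem matMulExponent_nonneg (F : Type*) [Field F] : 0 ≤ matMulExponent F := by
  refine Real.sInf_nonneg ?_
  rintro τ ⟨C, hC⟩
  by_contra! hτ
  -- The rank is at least 1 because `1 * 1 ≠ 0`, whereas a negative exponent would force the bound
  -- to tend to 0.
  have hone : ∀ n : ℕ, 0 < n → 1 ≤ C * (n : ℝ) ^ τ := by
    intro n hn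
    obtain ⟨R, ⟨u, v, w, h⟩, hR⟩ := hC n hn
    refine le_trans ?_ hR
    rw [Nat.one_le_cast, Nat.one_le_iff_ne_zero]
    rintro rfl
    have h1 := h 1 1
    have : NeZero n := ⟨hn.ne'⟩
    simp at h1
  have hlim : Filter.Tendsto (fun n : ℕ => C * (n : ℝ) ^ τ) Filter.atTop (nhds (C * 0)) := by
    have := (tendsto_rpow_neg_atTop (neg_pos.2 hτ)).comp tendsto_natCast_atTop_atTop
    simp only [neg_neg] at this
    exact this.const_mul C
  rw [mul_zero] at hlim
  have := ge_of_tendsto hlim (Filter.eventually_atTop.2 ⟨1, fun n hn => hone n hn⟩)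
  norm_num at this

theorem computable_search_bound : Computable fun x : ℕ => 16000 * (x + 1) ^ x := by
  have hpow : Primrec₂ ((· ^ ·) : ℕ → ℕ → ℕ) := Primrec₂.unpaired'.1 Nat.Primrec.pow
  exact (Primrec.nat_mul.comp (Primrec.const 16000)
    (hpow.comp Primrec.succ Primrec.id)).to_comp

/-- For `k ≥ 1` and `Δ ≥ 2` one has `Δ + 1 ≤ (k * Δ)^2`, so exponent `2 k log (k Δ)` suffices; 16000
replaces 2 so that one constant serves in both places of the final bound. For `k = 0` both sides are
1. -/
theorem pow_le_two_rpow {k Δ : ℕ} (hΔ : 2 ≤ Δ) :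
    ((Δ : ℝ) + 1) ^ k ≤ (2 : ℝ) ^ (16000 * ((k : ℝ) * Real.logb 2 ((k : ℝ) * (Δ : ℝ)))) := by
  rcases Nat.eq_zero_or_pos k with rfl | hk
  · simp
  have hk' : (1 : ℝ) ≤ k := by exact_mod_cast hk
  have hΔ' : (2 : ℝ) ≤ Δ := by exact_mod_cast hΔ
  have hkΔ : (2 : ℝ) ≤ (k : ℝ) * Δ := by nlinarith
  have hlog : 0 ≤ Real.logb 2 ((k : ℝ) * Δ) := Real.logb_nonneg (by norm_num) (by linarith)
  calc ((Δ : ℝ) + 1) ^ k ≤ (((k : ℝ) * Δ) ^ 2) ^ k := by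
        gcongr
        nlinarith
    _ = (2 : ℝ) ^ (Real.logb 2 ((k : ℝ) * Δ) * ((2 * k : ℕ) : ℝ)) := by
        rw [Real.rpow_mul (by norm_num), Real.rpow_logb (by norm_num) (by norm_num) (by linarith),
          Real.rpow_natCast, pow_mul]
    _ ≤ _ := by
        refine Real.rpow_le_rpow_of_exponent_le (by norm_num) ?_
        push_cast
        nlinarith [mul_nonneg (zero_le_one.trans hk') hlog]

theorem mainTheorem6 :
    -- minimal topological hitting sets induce connected subgraphs of the Hasse graph, and those
    -- with at most `k` members lie in the ball of radius `2k` around each of their members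
    (∀ (V : Type*) [Finite V] (K : AbstractSimplicialComplex V) (r : ℕ) (_ : r < K.dim)
        (ζ : K.Chain r) (_ : ζ ∈ K.cycles r) (_ : ζ ∉ K.boundaries r)
        (S : Finset (K.Face r)), Minimal (K.IsHittingSet ζ) S →
        K.InducesConnected S ∧
        ∀ k : ℕ, S.card ≤ k → ∀ τ ∈ S, ∀ s ∈ S,
          s.toSimplex ∈ K.hasseBall τ.toSimplex (2 * k)) ∧
    -- so the search may be restricted to connected sets within distance `2k` of an `r`-simplex
    (∀ I : THSInstance,
        (∃ S : Finset (I.K.Face I.r), S.card ≤ I.k ∧ I.K.IsHittingSet I.ζ S) ↔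
        ∃ (τ : I.K.Face I.r) (S : Finset (I.K.Face I.r)),
          (∀ s ∈ S, s.toSimplex ∈ I.K.hasseBall τ.toSimplex (2 * I.k)) ∧
          I.K.InducesConnected S ∧ S.card ≤ I.k ∧ I.K.IsHittingSet I.ζ S) ∧
    -- the algorithm, with its running time, which is fixed-parameter tractable in `k + Δ`
    (∃ (P : RAM.Cmd) (a : ℕ) (C : ℝ) (f : ℕ → ℕ) (c : ℕ), Computable f ∧
        ∀ (I : THSInstance) (e : Fin I.K.size ≃ I.K.Simplex),
          ∃ (t : ℕ) (σ : RAM.Store),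
            RAM.Run ((I.K.size + I.k + 2) ^ a) P (I.input e) t σ ∧
            I.Answers e σ ∧
            (t : ℝ) ≤ C * (I.K.size : ℝ) ^ (6 + matMulExponent (ZMod 2)) *
              (2 : ℝ) ^ (C * ((I.k : ℝ) * Real.logb 2 ((I.k : ℝ) * (I.K.maxHasseDegree : ℝ)))) ∧
            t ≤ f (I.k + I.K.maxHasseDegree) * I.K.size ^ c) := by
  refine ⟨fun V _ K r _ ζ hζ _ S hS => ?_, fun I =>
    AbstractSimplicialComplex.exists_isHittingSet_iff_exists_connected I.isCycle I.k,
    -- Words are bounded by `(n + k + 2)^2` because the facet table has `n^2` cells; `16000 = 1000 *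
    -- 2^4` comes from `n + 1 ≤ 2 n`.
    CocycleSearch.mainProg, 2, 16000, fun x => 16000 * (x + 1) ^ x, 4, computable_search_bound,
    fun I e => ?_⟩
  · have hc := AbstractSimplicialComplex.cofacetGraph_induce_connected hζ hS
    exact ⟨AbstractSimplicialComplex.inducesConnected_of_cofacetGraph hc, fun k hk τ hτ s hs =>
      AbstractSimplicialComplex.mem_hasseBall_of_cofacetGraph hc hk hτ hs⟩
  · obtain ⟨t, σ, hrun, ht, hans⟩ := THSInstance.halts_mainProg e _ le_rfl
    have hn : 1 ≤ I.K.size := by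
      by_contra h
      have h0 : I.m = 0 := by have := I.m_le_size; omega
      have : IsEmpty (Fin I.m) := by rw [h0]; infer_instance
      have hdim : I.K.dim ≤ 0 := Finset.sup_le fun s _ => by simp [Finset.eq_empty_of_isEmpty s.1]
      have := I.r_lt
      omega
    have hpow : (I.K.size + 1) ^ 4 ≤ 16 * I.K.size ^ 4 := by
      calc (I.K.size + 1) ^ 4 ≤ (2 * I.K.size) ^ 4 := Nat.pow_le_pow_left (by omega) 4
        _ = _ := by ring
    have ht' : t ≤ 16000 * I.K.size ^ 4 * (I.K.maxHasseDegree + 1) ^ I.k := by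
      refine ht.trans (Nat.mul_le_mul_right _ ?_)
      omega
    refine ⟨t, σ, hrun, hans, ?_, ?_⟩
    · have hn' : (1 : ℝ) ≤ I.K.size := by exact_mod_cast hn
      -- Since `ω ≥ 0`, the exponent 4 is below `6 + ω`.
      have h₁ : (I.K.size : ℝ) ^ 4 ≤ (I.K.size : ℝ) ^ (6 + matMulExponent (ZMod 2)) := by
        rw [← Real.rpow_natCast]
        refine Real.rpow_le_rpow_of_exponent_le hn' ?_
        have := matMulExponent_nonneg (ZMod 2)
        push_cast
        linarith
      have h₂ := pow_le_two_rpow (k := I.k) I.two_le_maxHasseDegree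
      calc (t : ℝ) ≤ 16000 * (I.K.size : ℝ) ^ 4 * ((I.K.maxHasseDegree : ℝ) + 1) ^ I.k := by
            exact_mod_cast ht'
        _ ≤ _ := by gcongr
    · refine ht'.trans ?_
      -- Base and exponent are both enlarged to depend on `k + Δ` alone.
      have h₃ : (I.K.maxHasseDegree + 1) ^ I.k ≤
          (I.k + I.K.maxHasseDegree + 1) ^ (I.k + I.K.maxHasseDegree) :=
        (Nat.pow_le_pow_left (by omega) _).trans (Nat.pow_le_pow_right (by omega) (by omega))
      calc _ ≤ 16000 * I.K.size ^ 4 *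
            (I.k + I.K.maxHasseDegree + 1) ^ (I.k + I.K.maxHasseDegree) := by gcongr
        _ = _ := by ring
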